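/- Let $M=(m_j)_{j\ge 0}$ be an increasing sequence of positive real numbers with $m_0=1$, logarithmically convex ($m_{j+1}/m_j\le m_{j+2}/m_{j+1}$ for all $j\ge 0$), and with $\sup_{j\ge1}(m_{j+1}/m_j)^{1/j}<\infty$; call such a sequence a weight. For an open set $U\subset\mathbb R^n$, let $C^M_n(U)$ be the set of smooth functions $f:U\to\mathbb C$ for which there are constants $A,B>0$ with $|D^\alpha f(x)|\le |\alpha|!\,A\,B^{|\alpha|}m_{|\alpha|}$ for all $x\in U$, $\alpha\in\mathbb N^n$. Let $C^M_{n,0}$ be the ring of germs at $0\in\mathbb R^n$ of such functions. It is called quasi-analytic if it properly contains the ring of real analytic germs at $0$ and the map sending a germ in $C^M_{n,0}$ to its Taylor series at $0$ is injective. Let $C^M_{+,0}$ be the set of germs at $0$ of smooth functions $f:[0,\varepsilon)\to\mathbb C$, $\varepsilon>0$, with $|f^{(k)}(x)|\le k!\,A\,B^k m_k$ for some $A,B>0$ and all $k\in\mathbb N$, $x\in[0,\varepsilon)$. Write points of $\mathbb R^n$ as $(x',t)$ with $x'=(x_1,\dots,x_{n-1})\in\mathbb R^{n-1}$ and $t\in\mathbb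 R$. A germ $g\in C^M_{n,0}$ is regular of order $e$ in $t$ if $g(0,t)=u(0,t)\,t^e$ for some unit $u$ of $C^M_{n,0}$. A distinguished Weierstrass polynomial over $C^M_{n-1,0}$ is a germ of the form $t^e+\sum_{j<e}a_j(x')\,t^j$ with $e\ge 0$, $a_j\in C^M_{n-1,0}$ and $a_j(0)=0$. A germ can be prepared in $C^M_{n,0}$ if it is the product of a unit of $C^M_{n,0}$ and a distinguished Weierstrass polynomial over $C^M_{n-1,0}$. Theorem. Let $n\ge 2$, and let $M$ and $\widetilde M$ be weights such that $C^M_{n,0}$ and $C^{\widetilde M}_{n,0}$ are quasi-analytic and $C^M_{n,0}\subseteq C^{\widetilde M}_{n,0}$. Then there exists a germ $g\in C^M_{n,0}$, regular of order $2$ in $t$, that cannot be prepared in $C^{\widetilde M}_{n,0}$. Moreover, $g$ can be taken of the form $g(x',t)=f(t^2)-x_1$, where, for some weight $K$ with $C^K_{1,0}$ quasi-analytic and $C^{\widetilde M}_{1,0}\subseteq C^K_{1,0}$, the function $f$ defines a germ in $C^K_{1,0}$ whose restriction to $[0,\infty)$ belongs to $C^M_{+,0}$ but is not the restriction to $[0,\infty)$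 of any germ in $C^{\widetilde M}_{1,0}$. -/

import Mathlib

namespace DenjoyCarleman

open Set Filter Topology
open scoped ContDiff Nat

/-- The standing assumptions on a weight sequence `M = (m_0, m_1, …)`: an increasing sequence of
positive real numbers with `m_0 = 1`, logarithmically convex, with
`sup_j (m_{j+1} / m_j)^{1/j} < ∞`. -/
structure IsWeight (m : ℕ → ℝ) : Prop where
  zero : m 0 = 1
  pos : ∀ j, 0 < m j
  mono : Monotone m
  logConvex : ∀ j, m (j + 1) / m j ≤ m (j + 2) / m (j + 1)
  root_bdd : ∃ C : ℝ, ∀ j : ℕ, 1 ≤ j → (m (j + 1) / m j) ^ (1 / (j : ℝ)) ≤ C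

/-- The mixed partial derivative `D^α f (x)` for a multi-index `α ∈ ℕⁿ`: the derivative of order
`|α| = ∑ i, α i` in the directions `e_0` (`α 0` times), `e_1` (`α 1` times), and so on. -/
noncomputable def partialDeriv {n : ℕ} (α : Fin n → ℕ) (f : (Fin n → ℝ) → ℂ) (x : Fin n → ℝ) : ℂ :=
  iteratedFDeriv ℝ (∑ i, α i) f x
    (fun j => Pi.single (finSigmaFinEquiv.symm j).1 (1 : ℝ))

/-- `f` belongs to the Denjoy–Carleman class `C^M_n(U)` (used for open sets `U`). -/
def InClass (m : ℕ → ℝ) {n : ℕ} (U : Set (Fin n → ℝ)) (f : (Fin n → ℝ) → ℂ) : Prop :=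
  ContDiffOn ℝ ∞ f U ∧
    ∃ A B : ℝ, 0 < A ∧ 0 < B ∧ ∀ x ∈ U, ∀ α : Fin n → ℕ,
      ‖partialDeriv α f x‖ ≤ ((∑ i, α i)! : ℝ) * A * B ^ (∑ i, α i) * m (∑ i, α i)

/-- The germ at the origin of `f` belongs to the ring `C^M_{n,0}`. Germs are represented by
functions on `ℝⁿ`; two functions represent the same germ iff they are equal near the origin. -/
def InRing (m : ℕ → ℝ) {n : ℕ} (f : (Fin n → ℝ) → ℂ) : Prop :=
  ∃ U : Set (Fin n → ℝ), IsOpen U ∧ 0 ∈ U ∧ InClass m U f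

/-- The Taylor series at the origin, `∑_α D^α f(0) / α! z^α`. -/
noncomputable def taylor {n : ℕ} (f : (Fin n → ℝ) → ℂ) : MvPowerSeries (Fin n) ℂ :=
  fun α => partialDeriv (fun i => α i) f 0 / ((∏ i, (α i)! : ℕ) : ℂ)

/-- The ring `C^M_{n,0}` is quasi-analytic: it properly contains the ring of real analytic germs,
and the Taylor map at the origin is injective on it. -/
structure IsQuasiAnalytic (m : ℕ → ℝ) (n : ℕ) : Prop where
  analytic_ssubset :
    {f : (Fin n → ℝ) → ℂ | AnalyticAt ℝ f 0} ⊂ {f : (Fin n → ℝ) → ℂ | InRing m f}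
  taylor_injective : ∀ f g : (Fin n → ℝ) → ℂ,
    InRing m f → InRing m g → taylor f = taylor g → f =ᶠ[𝓝 0] g

/-- `C^M_{n,0} ⊆ C^N_{n,0}`. -/
def RingLE (m m' : ℕ → ℝ) (n : ℕ) : Prop :=
  ∀ f : (Fin n → ℝ) → ℂ, InRing m f → InRing m' f

/-- The germ of `u` is a unit of the ring `C^M_{n,0}`. -/
def IsUnitGerm (m : ℕ → ℝ) {n : ℕ} (u : (Fin n → ℝ) → ℂ) : Prop :=
  InRing m u ∧ ∃ v : (Fin n → ℝ) → ℂ, InRing m v ∧ ∀ᶠ x in 𝓝 0, u x * v x = 1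

/-- The germ `f ∈ C^M_{d+1,0}` is regular of order `e` in the last variable: for some unit `u` of
the ring, `f(0, t) = u(0, t) t^e` near `t = 0`. -/
def IsRegular (m : ℕ → ℝ) {d : ℕ} (e : ℕ) (f : (Fin (d + 1) → ℝ) → ℂ) : Prop :=
  ∃ u : (Fin (d + 1) → ℝ) → ℂ, IsUnitGerm m u ∧
    ∀ᶠ t : ℝ in 𝓝 0,
      f (Fin.snoc (α := fun _ => ℝ) (0 : Fin d → ℝ) t) =
        u (Fin.snoc (α := fun _ => ℝ) (0 : Fin d → ℝ) t) * (t : ℂ) ^ e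

/-- `P` is a distinguished Weierstrass polynomial of degree `e` in the last variable over
`C^M_{d,0}`: `P(x', t) = t^e + ∑_{j < e} a_j(x') t^j` with `a_j ∈ C^M_{d,0}` and `a_j(0) = 0`. -/
def IsDistinguished (m : ℕ → ℝ) {d : ℕ} (e : ℕ) (P : (Fin (d + 1) → ℝ) → ℂ) : Prop :=
  ∃ a : Fin e → (Fin d → ℝ) → ℂ, (∀ j, InRing m (a j) ∧ a j 0 = 0) ∧
    ∀ᶠ x in 𝓝 0, P x = (x (Fin.last d) : ℂ) ^ e
      + ∑ j : Fin e, a j (Fin.init x) * (x (Fin.last d) : ℂ) ^ (j : ℕ)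

/-- The germ of `f` can be prepared in `C^M_{d+1,0}`: it is the product of a unit of that ring and
a distinguished Weierstrass polynomial (of any degree) in the last variable over `C^M_{d,0}`. -/
def CanBePrepared (m : ℕ → ℝ) {d : ℕ} (f : (Fin (d + 1) → ℝ) → ℂ) : Prop :=
  ∃ (e : ℕ) (u P : (Fin (d + 1) → ℝ) → ℂ),
    IsUnitGerm m u ∧ IsDistinguished m e P ∧ ∀ᶠ x in 𝓝 0, f x = u x * P x

/-- The right germ at `0` of `f : ℝ → ℂ` belongs to `C^M_{+,0}`: on some `[0, ε)` the function is
smooth up to the boundary point and satisfies the Denjoy–Carleman bounds. -/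
def InHalfRing (m : ℕ → ℝ) (f : ℝ → ℂ) : Prop :=
  ∃ ε : ℝ, 0 < ε ∧ ContDiffOn ℝ ∞ f (Ico 0 ε) ∧
    ∃ A B : ℝ, 0 < A ∧ 0 < B ∧ ∀ k : ℕ, ∀ x ∈ Ico 0 ε,
      ‖iteratedDerivWithin k f (Ico 0 ε) x‖ ≤ (k ! : ℝ) * A * B ^ k * m k

/-- The right germ at `0` of `f : ℝ → ℂ` is the restriction of a germ in `C^M_{1,0}`. -/
def ExtendsTo (m : ℕ → ℝ) (f : ℝ → ℂ) : Prop :=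
  ∃ h : (Fin 1 → ℝ) → ℂ, InRing m h ∧ ∀ᶠ t : ℝ in 𝓝[≥] 0, h (fun _ => t) = f t

end DenjoyCarleman

/-! The germ is `f(t²) - x₁` with `f(x) = x q(x)`, `q` real and `q ≥ 1/2` on `[0, ∞)`. If it equals
a unit times a distinguished polynomial over the class of `m'`, comparing orders of vanishing on the
`t`-axis gives degree 2. Over the point `x₁ = f(τ²)` of the `x₁`-axis both `τ` and `-τ` are roots;
adding the two equations gives `a₀ = -τ²` there. So `-Re a₀`, restricted to that axis, is a left
inverse of `f` on some `[0, ε)`. Its derivative at 0 is `1 / q 0`, and the inverse function theorem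
in the class of `m'` makes the right germ of `f` extend to that class (`extendsTo_of_canBePrepared`,
`extendsTo_of_left_inverse`). The inverse solves an autonomous equation `ψ' = w ∘ ψ` with `w` in the
class, which is how its derivatives are estimated (`DCOn.of_ode`).

It remains to find an `f` that is of class `m` on the right of 0 but does not extend to class `m'`.
Quasi-analyticity of `m'` forces divergence of the Denjoy–Carleman series
(`not_summable_of_taylor_injective`), and the Abel–Dini theorem then yields a weight `k` that is
still quasi-analytic in one variable but outgrows `R ^ j * m' j` for every `R`
(`exists_larger_weight`). The function is essentially the real part of a sum of simple fractions
with poles above `-1/(l+1)` and accumulating at 0 (`exists_half_regular_function`). Seen from `[0,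
∞)` the `l`-th pole is at distance at least `1/(l+1)`, so it contributes geometric growth, which `m`
dominates. Its height is tuned so that on the whole line the bounds of `k` hold while some
derivative at `-1/(l+1)` violates the bounds of `m'` with constant `l + 1`.

An extension of the right germ in the class of `m'` would have the Taylor series of `f` at 0. Both
lie in the quasi-analytic class of `k`, so they would agree on both sides of 0, against the size of
the derivatives at `-1/(l+1)` (`not_extendsTo`). Finally `f(t²)` only sees `f` on the right, and
substituting a square stays in the class of `m` (`DCOn.comp_sq`). -/

namespace DenjoyCarleman

open Set Filter Topology
open scoped ContDiff Nat

/-! ### Weight sequences -/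

namespace IsWeight

variable {m : ℕ → ℝ}

lemma one_le (hm : IsWeight m) (j : ℕ) : 1 ≤ m j := by
  rw [← hm.zero]; exact hm.mono (Nat.zero_le j)

lemma ratio_pos (hm : IsWeight m) (j : ℕ) : 0 < m (j + 1) / m j :=
  div_pos (hm.pos _) (hm.pos _)

lemma ratio_mono (hm : IsWeight m) : Monotone fun j => m (j + 1) / m j :=
  monotone_nat_of_le_succ hm.logConvex

lemma succ_eq (hm : IsWeight m) (j : ℕ) : m (j + 1) = m (j + 1) / m j * m j := by
  field_simp [(hm.pos j).ne']

/-- Log-convexity makes the ratios increase, and `m 0 = 1` starts the induction. This absorbs the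
products of weights produced by the Leibniz rule. -/
lemma mul_le (hm : IsWeight m) (i j : ℕ) : m i * m j ≤ m (i + j) := by
  induction i with
  | zero => simp [hm.zero]
  | succ i ih =>
    have h1 : m (i + 1) / m i ≤ m (i + j + 1) / m (i + j) := hm.ratio_mono (Nat.le_add_right i j)
    calc m (i + 1) * m j = m (i + 1) / m i * (m i * m j) := by
          rw [hm.succ_eq i]; field_simp [(hm.pos i).ne']
      _ ≤ m (i + j + 1) / m (i + j) * m (i + j) :=
          mul_le_mul h1 ih (mul_pos (hm.pos _) (hm.pos _)).le (hm.ratio_pos _).le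
      _ = m (i + 1 + j) := by
          rw [← hm.succ_eq]; congr 1; ring

/-- The root condition in the form that makes the classes stable under differentiation; taking the
maximum with `m 1` covers `j = 0`, about which the condition says nothing. -/
lemma exists_succ_le (hm : IsWeight m) : ∃ C : ℝ, 1 ≤ C ∧ ∀ j, m (j + 1) ≤ C ^ (j + 1) * m j := by
  obtain ⟨C, hC⟩ := hm.root_bdd
  refine ⟨max C (m 1), le_max_of_le_right (hm.one_le 1), fun j => ?_⟩
  have h1 : 1 ≤ max C (m 1) := le_max_of_le_right (hm.one_le 1)
  rcases Nat.eq_zero_or_pos j with rfl | hj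
  · simp [hm.zero]
  · have h := hC j hj
    have hp := (hm.ratio_pos j).le
    have hle : m (j + 1) / m j ≤ C ^ j := by
      have h2 : ((m (j + 1) / m j) ^ (1 / (j : ℝ))) ^ j ≤ C ^ j :=
        pow_le_pow_left₀ (Real.rpow_nonneg hp _) h j
      rwa [one_div, Real.rpow_inv_natCast_pow hp hj.ne'] at h2
    have hC0 : 0 ≤ C := (Real.rpow_nonneg hp _).trans h
    have : m (j + 1) / m j ≤ max C (m 1) ^ (j + 1) :=
      hle.trans ((pow_le_pow_left₀ hC0 (le_max_left _ _) j).trans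
        (pow_le_pow_right₀ h1 (Nat.le_succ j)))
    rwa [div_le_iff₀ (hm.pos j)] at this

lemma le_pow_of_ratio_le (hm : IsWeight m) {C : ℝ} (hC : ∀ j, m (j + 1) / m j ≤ C) (j : ℕ) :
    m j ≤ C ^ j := by
  have hC0 : 0 ≤ C := (hm.ratio_pos 0).le.trans (hC 0)
  induction j with
  | zero => simp [hm.zero]
  | succ j ih =>
    rw [hm.succ_eq, pow_succ']
    exact mul_le_mul (hC j) ih (hm.pos j).le hC0

/-- A weight that is not dominated by a geometric sequence dominates every geometric sequence. -/
lemma exists_pow_le (hm : IsWeight m) (h : ¬ ∃ C : ℝ, ∀ j, m j ≤ C ^ j) (R : ℝ) (hR : 1 ≤ R) :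
    ∃ S : ℝ, 0 < S ∧ ∀ i, R ^ i ≤ S * m i := by
  have hunb : ∃ j, R < m (j + 1) / m j := by
    by_contra! hcon
    exact h ⟨R, hm.le_pow_of_ratio_le hcon⟩
  obtain ⟨j, hj⟩ := hunb
  have hR0 : 0 < R := by linarith
  -- From index `j` on each ratio exceeds `R`; the factor `R ^ j` pays for the earlier indices.
  refine ⟨R ^ j, by positivity, fun i => ?_⟩
  rcases le_total i j with hij | hij
  · calc R ^ i ≤ R ^ j := pow_le_pow_right₀ hR hij
      _ = R ^ j * 1 := (mul_one _).symm
      _ ≤ R ^ j * m i := by gcongr; exact hm.one_le i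
  · induction i, hij using Nat.le_induction with
    | base => exact le_mul_of_one_le_right (by positivity) (hm.one_le _)
    | succ i hi ih =>
      have h1 : R ≤ m (i + 1) / m i := hj.le.trans (hm.ratio_mono hi)
      calc R ^ (i + 1) = R * R ^ i := pow_succ' _ _
        _ ≤ m (i + 1) / m i * (R ^ j * m i) :=
            mul_le_mul h1 ih (by positivity) (hm.ratio_pos i).le
        _ = R ^ j * m (i + 1) := by rw [hm.succ_eq i]; field_simp [(hm.pos i).ne']

end IsWeight

/-! ### Denjoy–Carleman classes on subsets of the line -/

section

variable {F : Type*} [NormedAddCommGroup F] [NormedSpace ℝ F]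

/-- `f` is smooth at the points of `s` and satisfies the Denjoy–Carleman bounds of `m` on `s`. -/
structure DCOn (m : ℕ → ℝ) (s : Set ℝ) (f : ℝ → F) : Prop where
  contDiffAt : ∀ x ∈ s, ContDiffAt ℝ ∞ f x
  bound : ∃ A B : ℝ, 0 < A ∧ 0 < B ∧ ∀ k : ℕ, ∀ x ∈ s,
    ‖iteratedDeriv k f x‖ ≤ (k ! : ℝ) * A * B ^ k * m k

namespace DCOn

variable {m : ℕ → ℝ} {s t : Set ℝ} {f g : ℝ → F}

lemma contDiffAt_nat (hf : DCOn m s f) {x : ℝ} (hx : x ∈ s) (k : ℕ) : ContDiffAt ℝ k f x :=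
  (hf.contDiffAt x hx).of_le (by exact_mod_cast le_top)

lemma mono (hf : DCOn m s f) (h : t ⊆ s) : DCOn m t f :=
  ⟨fun x hx => hf.contDiffAt x (h hx), by
    obtain ⟨A, B, hA, hB, H⟩ := hf.bound
    exact ⟨A, B, hA, hB, fun k x hx => H k x (h hx)⟩⟩

lemma exists_bound_one_le (hf : DCOn m s f) (hm : IsWeight m) :
    ∃ A B : ℝ, 1 ≤ A ∧ 1 ≤ B ∧ ∀ k : ℕ, ∀ x ∈ s,
      ‖iteratedDeriv k f x‖ ≤ (k ! : ℝ) * A * B ^ k * m k := by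
  obtain ⟨A, B, hA, hB, H⟩ := hf.bound
  refine ⟨max A 1, max B 1, le_max_right _ _, le_max_right _ _, fun k x hx => (H k x hx).trans ?_⟩
  have := (hm.pos k).le
  gcongr <;> exact le_max_left _ _

lemma of_bounds (hm : IsWeight m) (hc : ∀ x ∈ s, ContDiffAt ℝ ∞ f x) {A B : ℝ}
    (H : ∀ k : ℕ, ∀ x ∈ s, ‖iteratedDeriv k f x‖ ≤ (k ! : ℝ) * A * B ^ k * m k)
    (hB : 0 ≤ B) : DCOn m s f := by
  refine ⟨hc, max A 1, max B 1, by positivity, by positivity, fun k x hx => (H k x hx).trans ?_⟩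
  have := (hm.pos k).le
  gcongr <;> exact le_max_left _ _

lemma add (hm : IsWeight m) (hf : DCOn m s f) (hg : DCOn m s g) :
    DCOn m s (fun x => f x + g x) := by
  obtain ⟨A, B, hA, hB, H⟩ := hf.bound
  obtain ⟨A', B', hA', hB', H'⟩ := hg.bound
  refine ⟨fun x hx => (hf.contDiffAt x hx).add (hg.contDiffAt x hx),
    A + A', max B B', by positivity, by positivity, fun k x hx => ?_⟩
  have h1 : iteratedDeriv k (fun x => f x + g x) x = iteratedDeriv k f x + iteratedDeriv k g x :=
    iteratedDeriv_fun_add (hf.contDiffAt_nat hx k) (hg.contDiffAt_nat hx k)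
  have := (hm.pos k).le
  rw [h1]
  calc _ ≤ (k ! : ℝ) * A * B ^ k * m k + (k ! : ℝ) * A' * B' ^ k * m k :=
        (norm_add_le _ _).trans (add_le_add (H k x hx) (H' k x hx))
    _ ≤ (k ! : ℝ) * A * (max B B') ^ k * m k + (k ! : ℝ) * A' * (max B B') ^ k * m k := by
        gcongr
        · exact le_max_left _ _
        · exact le_max_right _ _
    _ = _ := by ring

lemma clm {G : Type*} [NormedAddCommGroup G] [NormedSpace ℝ G] (L : F →L[ℝ] G)
    (hm : IsWeight m) (hf : DCOn m s f) : DCOn m s (fun x => L (f x)) := by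
  obtain ⟨A, B, hA, hB, H⟩ := hf.bound
  refine of_bounds hm (fun x hx => L.contDiff.contDiffAt.comp x (hf.contDiffAt x hx))
    (A := ‖L‖ * A) (fun k x hx => ?_) hB.le
  have h1 := L.norm_iteratedFDeriv_comp_left (hf.contDiffAt_nat hx k) (n := k) le_rfl
  rw [norm_iteratedFDeriv_eq_norm_iteratedDeriv, norm_iteratedFDeriv_eq_norm_iteratedDeriv] at h1
  calc _ ≤ ‖L‖ * ‖iteratedDeriv k f x‖ := h1
    _ ≤ ‖L‖ * ((k ! : ℝ) * A * B ^ k * m k) := by gcongr; exact H k x hx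
    _ = _ := by ring

lemma const (hm : IsWeight m) (c : F) : DCOn m s (fun _ => c) := by
  refine of_bounds hm (fun x _ => contDiffAt_const) (A := ‖c‖) (B := 1) (fun k x _ => ?_) zero_le_one
  rw [iteratedDeriv_const]
  have := hm.one_le k
  split_ifs with h
  · subst h; simp [hm.zero]
  · simp; positivity

lemma deriv (hm : IsWeight m) (hf : DCOn m s f) : DCOn m s (deriv f) := by
  obtain ⟨A, B, hA, hB, H⟩ := hf.bound
  obtain ⟨C, hC1, hC⟩ := hm.exists_succ_le
  have hC0 : 0 < C := by linarith
  refine ⟨fun x hx => ?_, A * B * C, 2 * B * C, by positivity, by positivity, fun k x hx => ?_⟩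
  · have h1 : ContDiffAt ℝ ∞ (fderiv ℝ f) x := (hf.contDiffAt x hx).fderiv_right (by simp)
    exact h1.clm_apply contDiffAt_const
  · rw [← iteratedDeriv_succ']
    -- The index shift costs `(k + 1) * C ^ (k + 1)`, which is absorbed into the geometric constant.
    have h2 : ((k + 1 : ℕ) : ℝ) ≤ 2 ^ k := by exact_mod_cast Nat.lt_two_pow_self
    calc _ ≤ ((k + 1)! : ℝ) * A * B ^ (k + 1) * m (k + 1) := H (k + 1) x hx
      _ ≤ ((k + 1)! : ℝ) * A * B ^ (k + 1) * (C ^ (k + 1) * m k) := by gcongr; exact hC k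
      _ = (k ! : ℝ) * A * B ^ (k + 1) * (C ^ (k + 1) * m k) * ((k + 1 : ℕ) : ℝ) := by
          rw [Nat.factorial_succ]; push_cast; ring
      _ ≤ (k ! : ℝ) * A * B ^ (k + 1) * (C ^ (k + 1) * m k) * 2 ^ k := by
          have := (hm.pos k).le
          gcongr
      _ = _ := by rw [mul_pow, mul_pow]; ring

/-- The Leibniz recursion for a reciprocal after factorials and weights are removed; the relation
between `R`, `A`, `B` and `c` is exactly what closes the induction. -/
lemma sum_geom_le {A B c R : ℝ} (hB : 0 ≤ B) (hR : c * R = B * (A + c))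
    (hc : 0 ≤ c) (k : ℕ) :
    A * ∑ i ∈ Finset.range k, B ^ (i + 1) * R ^ (k - 1 - i) ≤ c * R ^ k := by
  induction k with
  | zero => simpa using hc
  | succ k ih =>
    rw [Finset.sum_range_succ']
    have h1 : ∑ i ∈ Finset.range k, B ^ (i + 1 + 1) * R ^ (k + 1 - 1 - (i + 1))
        = B * ∑ i ∈ Finset.range k, B ^ (i + 1) * R ^ (k - 1 - i) := by
      rw [Finset.mul_sum]
      refine Finset.sum_congr rfl fun i _ => ?_
      rw [show k + 1 - 1 - (i + 1) = k - 1 - i by omega]; ring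
    rw [h1]
    calc _ = B * (A * ∑ i ∈ Finset.range k, B ^ (i + 1) * R ^ (k - 1 - i)) + A * B * R ^ k := by
          simp; ring
      _ ≤ B * (c * R ^ k) + A * B * R ^ k := by gcongr
      _ = (c * R) * R ^ k := by rw [hR]; ring
      _ = _ := by ring

lemma choose_mul_factorial_mul_factorial_real {k i : ℕ} (h : i ≤ k) :
    ((k.choose i : ℕ) : ℝ) * (i ! : ℝ) * ((k - i)! : ℝ) = (k ! : ℝ) := by
  exact_mod_cast Nat.choose_mul_factorial_mul_factorial h

/-- Applying the Leibniz rule to `f * f⁻¹ = 1` expresses the top derivative of the reciprocal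
through lower ones; strong induction and `sum_geom_le` finish. -/
lemma inv {𝕜 : Type*} [NormedField 𝕜] [NormedAlgebra ℝ 𝕜] {f : ℝ → 𝕜}
    (hm : IsWeight m) (hf : DCOn m s f) {c : ℝ} (hc : 0 < c) (hfc : ∀ x ∈ s, c ≤ ‖f x‖) :
    DCOn m s (fun x => (f x)⁻¹) := by
  obtain ⟨A, B, hA, hB, H⟩ := hf.bound
  have hne : ∀ x ∈ s, f x ≠ 0 := fun x hx h => by
    have := hfc x hx; rw [h, norm_zero] at this; linarith
  have hsm : ∀ x ∈ s, ContDiffAt ℝ ∞ (fun x => (f x)⁻¹) x := fun x hx =>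
    (hf.contDiffAt x hx).inv (hne x hx)
  set R : ℝ := B * (A + c) / c with hRdef
  have hR : c * R = B * (A + c) := by rw [hRdef]; field_simp
  have hR0 : 0 < R := by positivity
  refine ⟨hsm, c⁻¹, R, by positivity, hR0, ?_⟩
  intro k
  induction k using Nat.strong_induction_on with
  | _ k ih =>
  intro x hx
  rcases Nat.eq_zero_or_pos k with rfl | hk
  · simp only [iteratedDeriv_zero, norm_inv, Nat.factorial_zero, Nat.cast_one, one_mul, pow_zero,
      mul_one, hm.zero]
    exact inv_anti₀ hc (hfc x hx)
  set v : ℝ → 𝕜 := fun x => (f x)⁻¹ with hv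
  have hone : (f * v) =ᶠ[𝓝 x] fun _ => (1 : 𝕜) := by
    filter_upwards [(hf.contDiffAt x hx).continuousAt.eventually_ne (hne x hx)] with y hy
    simp [hv, hy]
  have hL := iteratedDeriv_mul (hf.contDiffAt_nat hx k)
    ((hsm x hx).of_le (by exact_mod_cast le_top) : ContDiffAt ℝ k v x)
  rw [hone.iteratedDeriv_eq k, iteratedDeriv_const, if_neg hk.ne', Finset.sum_range_succ'] at hL
  simp only [Nat.choose_zero_right, Nat.cast_one, one_mul, iteratedDeriv_zero, Nat.sub_zero] at hL
  have hmul : ‖f x‖ * ‖iteratedDeriv k v x‖ ≤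
      ∑ i ∈ Finset.range k, ((k.choose (i + 1) : ℕ) : ℝ) * ‖iteratedDeriv (i + 1) f x‖
        * ‖iteratedDeriv (k - (i + 1)) v x‖ := by
    rw [← norm_mul, eq_neg_of_add_eq_zero_right hL.symm, norm_neg]
    refine (norm_sum_le _ _).trans (Finset.sum_le_sum fun i _ => ?_)
    rw [norm_mul, norm_mul]
    gcongr
    rw [← map_natCast (algebraMap ℝ 𝕜), norm_algebraMap', Real.norm_natCast]
  have hterm : ∀ i ∈ Finset.range k, ((k.choose (i + 1) : ℕ) : ℝ) * ‖iteratedDeriv (i + 1) f x‖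
        * ‖iteratedDeriv (k - (i + 1)) v x‖ ≤
      (k ! : ℝ) * m k * c⁻¹ * (A * (B ^ (i + 1) * R ^ (k - 1 - i))) := by
    intro i hi
    have hik : i + 1 ≤ k := Finset.mem_range.1 hi
    have h1 := H (i + 1) x hx
    have h2 := ih (k - (i + 1)) (by omega) x hx
    have h3 : m (i + 1) * m (k - (i + 1)) ≤ m k := by
      have := hm.mul_le (i + 1) (k - (i + 1)); rwa [Nat.add_sub_cancel' hik] at this
    calc _ ≤ ((k.choose (i + 1) : ℕ) : ℝ) * (((i + 1)! : ℝ) * A * B ^ (i + 1) * m (i + 1))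
          * (((k - (i + 1))! : ℝ) * c⁻¹ * R ^ (k - (i + 1)) * m (k - (i + 1))) := by
          have := (hm.pos (i + 1)).le
          gcongr
      _ = (((k.choose (i + 1) : ℕ) : ℝ) * ((i + 1)! : ℝ) * ((k - (i + 1))! : ℝ)) *
          (A * B ^ (i + 1) * c⁻¹ * R ^ (k - (i + 1))) * (m (i + 1) * m (k - (i + 1))) := by ring
      _ ≤ (k ! : ℝ) * (A * B ^ (i + 1) * c⁻¹ * R ^ (k - (i + 1))) * m k := by
          rw [choose_mul_factorial_mul_factorial_real hik]
          gcongr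
      _ = _ := by rw [show k - (i + 1) = k - 1 - i by omega]; ring
  have hfin : c * ‖iteratedDeriv k v x‖ ≤ c * ((k ! : ℝ) * c⁻¹ * R ^ k * m k) := by
    calc c * ‖iteratedDeriv k v x‖ ≤ ‖f x‖ * ‖iteratedDeriv k v x‖ := by
          gcongr; exact hfc x hx
      _ ≤ _ := hmul.trans (Finset.sum_le_sum hterm)
      _ = (k ! : ℝ) * m k * c⁻¹ *
          (A * ∑ i ∈ Finset.range k, B ^ (i + 1) * R ^ (k - 1 - i)) := by
          rw [← Finset.mul_sum, ← Finset.mul_sum]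
      _ ≤ (k ! : ℝ) * m k * c⁻¹ * (c * R ^ k) := by
          have := (hm.pos k).le
          exact mul_le_mul_of_nonneg_left (sum_geom_le hB.le hR hc.le k) (by positivity)
      _ = _ := by ring
  exact le_of_mul_le_mul_left hfin hc

lemma iteratedDeriv_id_smul {G : ℝ → F} (hG : ContDiff ℝ ∞ G) (k : ℕ) :
    iteratedDeriv (k + 1) (fun t : ℝ => t • G t) =
      fun t => t • iteratedDeriv (k + 1) G t + ((k : ℝ) + 1) • iteratedDeriv k G t := by
  have hd : ∀ k t, HasDerivAt (iteratedDeriv k G) (iteratedDeriv (k + 1) G t) t := fun k t => by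
    rw [iteratedDeriv_succ]
    exact ((hG.differentiable_iteratedDeriv k (by exact_mod_cast WithTop.coe_lt_top _)) t).hasDerivAt
  induction k with
  | zero =>
    ext t
    rw [iteratedDeriv_one]
    refine ((hasDerivAt_id t).smul (hd 0 t)).deriv.trans ?_
    simp
  | succ k ih =>
    ext t
    rw [iteratedDeriv_succ, ih]
    have := (((hasDerivAt_id t).smul (hd (k + 1) t)).add ((hd k t).const_smul ((k : ℝ) + 1))).deriv
    refine this.trans ?_
    simp only [id, one_smul]
    push_cast
    module

/-- Substituting `t ^ 2` turns bounds on `[0, 1)` into bounds on `(-1, 1)`. -/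
lemma comp_sq (hm : IsWeight m) (hc : ContDiff ℝ ∞ f) (hf : DCOn m (Ico 0 1) f) :
    DCOn m (Ioo (-1) 1) (fun t => f (t ^ 2)) := by
  obtain ⟨A, B, hA, hB, H⟩ := hf.exists_bound_one_le hm
  have hsm : ∀ j, ContDiff ℝ ∞ (iteratedDeriv j f) := fun j =>
    by rw [iteratedDeriv_eq_iterate]; exact ContDiff.iterate_deriv j hc
  have hG : ∀ j, ContDiff ℝ ∞ (fun t : ℝ => iteratedDeriv j f (t ^ 2)) := fun j =>
    (hsm j).comp (contDiff_id.pow 2)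
  have hder : ∀ j, _root_.deriv (fun t : ℝ => iteratedDeriv j f (t ^ 2)) =
      fun t => (2 : ℝ) • (t • iteratedDeriv (j + 1) f (t ^ 2)) := fun j => by
    ext t
    have h1 : HasDerivAt (iteratedDeriv j f) (iteratedDeriv (j + 1) f (t ^ 2)) (t ^ 2) := by
      rw [iteratedDeriv_succ]
      exact ((hsm j).differentiable (by simp) _).hasDerivAt
    have := (HasDerivAt.scomp (h := fun x : ℝ => x ^ 2) t h1 (hasDerivAt_pow 2 t)).deriv
    refine this.trans ?_
    simp [smul_smul]
  -- All `j` are treated at once: one derivative of `f⁽ʲ⁾(t²)` gives `2 t f⁽ʲ⁺¹⁾(t²)`, and the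
  -- Leibniz rule against the factor `t` leaves only the orders `k + 1` and `k` at level `j + 1`.
  -- Only values of the derivatives of `f` on `[0, 1)` enter.
  have key : ∀ k j, ∀ t ∈ Ioo (-1 : ℝ) 1,
      ‖iteratedDeriv k (fun t : ℝ => iteratedDeriv j f (t ^ 2)) t‖ ≤
        ((j + k)! : ℝ) * A * B ^ (j + k) * 4 ^ k * m (j + k) := by
    intro k
    induction k using Nat.strong_induction_on with
    | _ k ih =>
    intro j t ht
    have ht1 : |t| ≤ 1 := (abs_lt.2 ht).le
    have ht2 : t ^ 2 ∈ Ico (0 : ℝ) 1 := ⟨sq_nonneg t, by rw [sq_lt_one_iff_abs_lt_one]; exact abs_lt.2 ht⟩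
    have hn2 : ‖(2 : ℝ)‖ = 2 := by norm_num
    match k, ih with
    | 0, _ => simpa using H j _ ht2
    | 1, ih =>
      rw [iteratedDeriv_one, hder, norm_smul, norm_smul, Real.norm_eq_abs t, hn2]
      have h1 := H (j + 1) _ ht2
      have hp := norm_nonneg (iteratedDeriv (j + 1) f (t ^ 2))
      calc _ ≤ 2 * (1 * ‖iteratedDeriv (j + 1) f (t ^ 2)‖) := by gcongr
        _ ≤ 4 * ‖iteratedDeriv (j + 1) f (t ^ 2)‖ := by linarith
        _ ≤ 4 * (((j + 1)! : ℝ) * A * B ^ (j + 1) * m (j + 1)) := by gcongr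
        _ = _ := by ring
    | k + 2, ih =>
      rw [iteratedDeriv_succ', hder]
      have h0 : iteratedDeriv (k + 1) (fun t : ℝ => (2 : ℝ) • (t • iteratedDeriv (j + 1) f (t ^ 2))) t
          = (2 : ℝ) • (t • iteratedDeriv (k + 1) (fun t : ℝ => iteratedDeriv (j + 1) f (t ^ 2)) t
            + ((k : ℝ) + 1) • iteratedDeriv k (fun t : ℝ => iteratedDeriv (j + 1) f (t ^ 2)) t) := by
        rw [iteratedDeriv_fun_const_smul_field]
        simp only [iteratedDeriv_id_smul (hG (j + 1))]
      have h1 := ih (k + 1) (by omega) (j + 1) t ht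
      have h2 := ih k (by omega) (j + 1) t ht
      rw [h0, norm_smul, hn2]
      set P := ‖iteratedDeriv (k + 1) (fun t : ℝ => iteratedDeriv (j + 1) f (t ^ 2)) t‖
      set Q := ‖iteratedDeriv k (fun t : ℝ => iteratedDeriv (j + 1) f (t ^ 2)) t‖
      have hmm : m (j + 1 + k) ≤ m (j + (k + 2)) := hm.mono (by omega)
      have hBB : B ^ (j + 1 + k) ≤ B ^ (j + (k + 2)) := pow_le_pow_right₀ hB (by omega)
      have hfac : ((k : ℝ) + 1) * ((j + 1 + k)! : ℝ) ≤ ((j + (k + 2))! : ℝ) := by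
        rw [show j + (k + 2) = (j + 1 + k) + 1 by ring, Nat.factorial_succ]
        push_cast
        gcongr
        linarith [(Nat.cast_nonneg j : (0 : ℝ) ≤ j)]
      have hm0 := (hm.pos (j + 1 + k)).le
      have hQ : ((k : ℝ) + 1) * Q ≤ ((j + (k + 2))! : ℝ) * A * B ^ (j + (k + 2)) * 4 ^ k
          * m (j + (k + 2)) := by
        calc ((k : ℝ) + 1) * Q
            ≤ ((k : ℝ) + 1) * (((j + 1 + k)! : ℝ) * A * B ^ (j + 1 + k) * 4 ^ k * m (j + 1 + k)) := by
              gcongr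
          _ = (((k : ℝ) + 1) * ((j + 1 + k)! : ℝ)) * A * B ^ (j + 1 + k) * 4 ^ k * m (j + 1 + k) := by
              ring
          _ ≤ _ := by gcongr
      have hP : |t| * P ≤ ((j + (k + 2))! : ℝ) * A * B ^ (j + (k + 2)) * 4 ^ (k + 1)
          * m (j + (k + 2)) := by
        rw [show j + 1 + (k + 1) = j + (k + 2) by ring] at h1
        calc |t| * P ≤ 1 * P := by gcongr
          _ ≤ _ := by rw [one_mul]; exact h1
      have hmp := (hm.pos (j + (k + 2))).le
      have hX : 0 ≤ ((j + (k + 2))! : ℝ) * A * B ^ (j + (k + 2)) * 4 ^ k * m (j + (k + 2)) := by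
        positivity
      calc _ ≤ 2 * (|t| * P + ((k : ℝ) + 1) * Q) := by
            gcongr
            refine (norm_add_le _ _).trans (le_of_eq ?_)
            rw [norm_smul, norm_smul, Real.norm_eq_abs, Real.norm_eq_abs,
              abs_of_nonneg (by positivity : (0 : ℝ) ≤ (k : ℝ) + 1)]
        -- The two terms add up to at most `2 * (4 + 1) = 10` units, and `4 ^ (k + 2)` provides 16.
        _ ≤ ((j + (k + 2))! : ℝ) * A * B ^ (j + (k + 2)) * 4 ^ (k + 2) * m (j + (k + 2)) := by
            have e1 : (4 : ℝ) ^ (k + 1) = 4 * 4 ^ k := pow_succ' _ _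
            have e2 : (4 : ℝ) ^ (k + 2) = 16 * 4 ^ k := by rw [pow_add]; ring
            rw [e1] at hP
            rw [e2]
            nlinarith
  have h00 : ∀ x, ContDiffAt ℝ ∞ (fun t : ℝ => f (t ^ 2)) x := fun x => by
    have := hG 0; simp only [iteratedDeriv_zero] at this; exact this.contDiffAt
  refine of_bounds hm (fun x _ => h00 x) (A := A) (B := 4 * B) (fun k x hx => ?_) (by linarith)
  have := key k 0 x hx
  simp only [iteratedDeriv_zero, zero_add] at this
  refine this.trans (le_of_eq ?_)
  rw [mul_pow]; ring

end DCOn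

end

/-! ### Autonomous differential equations in a Denjoy–Carleman class -/

/-- The functions `(w d/dx)^k w`: the derivatives of a solution of `ψ' = w ∘ ψ` are their values
along `ψ`. -/
noncomputable def flowDeriv (w : ℝ → ℝ) : ℕ → ℝ → ℝ
  | 0 => w
  | k + 1 => w * deriv (flowDeriv w k)

/-- The convolution of binomial coefficients in the Leibniz rule for `w * deriv (flowDeriv w k)`. -/
lemma sum_succ_mul_choose (k j : ℕ) :
    ∑ l ∈ Finset.range (j + 1), (l + 1) * (2 * k + l + 1).choose (l + 1) =
      (2 * k + 1) * (2 * k + 2 + j).choose j := by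
  have key : ∀ l, (l + 1) * (2 * k + l + 1).choose (l + 1)
      = (2 * k + 1) * (2 * k + l + 1).choose l := fun l => by
    have := Nat.choose_succ_right_eq (2 * k + l + 1) l
    rw [show 2 * k + l + 1 - l = 2 * k + 1 by omega] at this
    linarith
  induction j with
  | zero => simp
  | succ j ih =>
    rw [Finset.sum_range_succ, ih, key, show 2 * k + 2 + (j + 1) = (2 * k + 2 + j) + 1 by ring,
      show 2 * k + (j + 1) + 1 = 2 * k + 2 + j by ring, Nat.choose_succ_succ (2 * k + 2 + j)]
    ring

section

variable {m : ℕ → ℝ} {s t : Set ℝ} {w : ℝ → ℝ}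

lemma contDiffAt_deriv {f : ℝ → ℝ} {x : ℝ} (hf : ContDiffAt ℝ ∞ f x) :
    ContDiffAt ℝ ∞ (deriv f) x := by
  have h1 : ContDiffAt ℝ ∞ (fderiv ℝ f) x := hf.fderiv_right (by simp)
  exact h1.clm_apply contDiffAt_const

lemma contDiffAt_flowDeriv {x : ℝ} (hw : ContDiffAt ℝ ∞ w x) (k : ℕ) :
    ContDiffAt ℝ ∞ (flowDeriv w k) x := by
  induction k with
  | zero => exact hw
  | succ k ih => exact hw.mul (contDiffAt_deriv ih)

/-- The shape of the bound comes from the majorant `w = A / (1 - B x)`: there `(w d/dx)^k w` is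
`A^(k+1) B^k (2k-1)‼ (1 - B x)^(-(2k+1))`, whose Taylor coefficients are the binomials
`(2k+j).choose j`. The double factorial is relaxed to `2^k k!`, and the weights combine by `mul_le`.
-/
lemma norm_iteratedDeriv_flowDeriv_le (hm : IsWeight m) (hw : DCOn m s w) {A B : ℝ}
    (hA : 0 ≤ A) (hB : 0 ≤ B)
    (H : ∀ k : ℕ, ∀ x ∈ s, ‖iteratedDeriv k w x‖ ≤ (k ! : ℝ) * A * B ^ k * m k)
    {x : ℝ} (hx : x ∈ s) (k j : ℕ) :
    ‖iteratedDeriv j (flowDeriv w k) x‖ ≤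
      (j ! : ℝ) * (A ^ (k + 1) * B ^ (k + j) * (2 ^ k * (k ! : ℝ)) * ((2 * k + j).choose j : ℝ))
        * m (k + j) := by
  induction k generalizing j with
  | zero =>
    simpa [flowDeriv, mul_assoc] using H j x hx
  | succ k ih =>
    have hsm := contDiffAt_flowDeriv (hw.contDiffAt x hx) k
    have hle : ∀ n : ℕ, (n : WithTop ℕ∞) ≤ ∞ := fun n => by exact_mod_cast le_top
    have hL := iteratedDeriv_mul (n := j) ((hw.contDiffAt x hx).of_le (hle j))
      ((contDiffAt_deriv hsm).of_le (hle j))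
    have h0 : iteratedDeriv j (flowDeriv w (k + 1)) x = _ := hL
    rw [h0]
    have hterm : ∀ i ∈ Finset.range (j + 1),
        ‖((j.choose i : ℕ) : ℝ) * iteratedDeriv i w x *
          iteratedDeriv (j - i) (deriv (flowDeriv w k)) x‖ ≤
        ((j ! : ℝ) * (A ^ (k + 2) * B ^ (k + 1 + j) * (2 ^ k * (k ! : ℝ))) * m (k + 1 + j)) *
          (((j - i + 1) * (2 * k + (j - i) + 1).choose (j - i + 1) : ℕ) : ℝ) := by
      intro i hi
      have hij : i ≤ j := Nat.lt_succ_iff.1 (Finset.mem_range.1 hi)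
      obtain ⟨l, rfl⟩ := Nat.exists_eq_add_of_le hij
      rw [show i + l - i = l by omega, ← iteratedDeriv_succ', norm_mul, norm_mul, Real.norm_natCast]
      have h1 := H i x hx
      have h2 := ih (l + 1)
      have h3 := hm.mul_le i (k + (l + 1))
      have h4 : (((i + l).choose i : ℕ) : ℝ) * (i ! : ℝ) * (l ! : ℝ) = ((i + l)! : ℝ) := by
        have := DCOn.choose_mul_factorial_mul_factorial_real (Nat.le_add_right i l)
        rwa [show i + l - i = l by omega] at this
      calc _ ≤ (((i + l).choose i : ℕ) : ℝ) * ((i ! : ℝ) * A * B ^ i * m i) *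
            (((l + 1)! : ℝ) * (A ^ (k + 1) * B ^ (k + (l + 1)) * (2 ^ k * (k ! : ℝ)) *
              ((2 * k + (l + 1)).choose (l + 1) : ℝ)) * m (k + (l + 1))) := by
            have := (hm.pos i).le
            gcongr
        _ = ((((i + l).choose i : ℕ) : ℝ) * (i ! : ℝ) * (l ! : ℝ)) * (A ^ (k + 2) *
              B ^ (k + 1 + (i + l)) * (2 ^ k * (k ! : ℝ))) * (m i * m (k + (l + 1))) *
              (((l : ℝ) + 1) * ((2 * k + (l + 1)).choose (l + 1) : ℝ)) := by
            rw [Nat.factorial_succ]; push_cast; ring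
        _ ≤ ((i + l)! : ℝ) * (A ^ (k + 2) *
              B ^ (k + 1 + (i + l)) * (2 ^ k * (k ! : ℝ))) * m (i + (k + (l + 1))) *
              (((l : ℝ) + 1) * ((2 * k + (l + 1)).choose (l + 1) : ℝ)) := by
            rw [h4]; gcongr
        _ = _ := by
            rw [show i + (k + (l + 1)) = k + 1 + (i + l) by ring,
              show 2 * k + (l + 1) = 2 * k + l + 1 by ring]
            push_cast; ring
    refine (norm_sum_le _ _).trans ((Finset.sum_le_sum hterm).trans ?_)
    rw [← Finset.mul_sum, ← Nat.cast_sum]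
    have hsum : ∑ i ∈ Finset.range (j + 1), (j - i + 1) * (2 * k + (j - i) + 1).choose (j - i + 1)
        = (2 * k + 1) * (2 * k + 2 + j).choose j := by
      rw [← sum_succ_mul_choose]
      exact Finset.sum_range_reflect
        (fun l => (l + 1) * (2 * k + l + 1).choose (l + 1)) (j + 1) |>.symm ▸
        Finset.sum_congr rfl fun i _ => by simp
    rw [hsum]
    have hmp := (hm.pos (k + 1 + j)).le
    have h5 : ((2 * k + 1 : ℕ) : ℝ) ≤ 2 * ((k + 1 : ℕ) : ℝ) := by push_cast; linarith
    calc _ = ((j ! : ℝ) * (A ^ (k + 2) * B ^ (k + 1 + j) * (2 ^ k * (k ! : ℝ))) * m (k + 1 + j)) *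
          ((2 * k + 2 + j).choose j : ℝ) * ((2 * k + 1 : ℕ) : ℝ) := by push_cast; ring
      _ ≤ ((j ! : ℝ) * (A ^ (k + 2) * B ^ (k + 1 + j) * (2 ^ k * (k ! : ℝ))) * m (k + 1 + j)) *
          ((2 * k + 2 + j).choose j : ℝ) * (2 * ((k + 1 : ℕ) : ℝ)) := by gcongr
      _ = _ := by
          rw [Nat.factorial_succ, show 2 * (k + 1) + j = 2 * k + 2 + j by ring]; push_cast; ring

/-- A bounded solution of the autonomous equation `ψ' = w ∘ ψ` inherits the class of `w`. -/
lemma DCOn.of_ode (hm : IsWeight m) (hw : DCOn m s w) (ht : IsOpen t) {ψ : ℝ → ℝ}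
    (hmap : MapsTo ψ t s) (hψ : ∀ y ∈ t, HasDerivAt ψ (w (ψ y)) y) {D : ℝ}
    (hD : ∀ y ∈ t, ‖ψ y‖ ≤ D) : DCOn m t ψ := by
  obtain ⟨A, B, hA, hB, H⟩ := hw.exists_bound_one_le hm
  have hder : ∀ k, ∀ y ∈ t, HasDerivAt (iteratedDeriv k ψ) (flowDeriv w k (ψ y)) y := by
    intro k
    induction k with
    | zero => intro y hy; simpa [flowDeriv] using hψ y hy
    | succ k ih =>
      intro y hy
      have heq : iteratedDeriv (k + 1) ψ =ᶠ[𝓝 y] fun z => flowDeriv w k (ψ z) := by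
        filter_upwards [ht.mem_nhds hy] with z hz
        rw [iteratedDeriv_succ]; exact (ih z hz).deriv
      refine HasDerivAt.congr_of_eventuallyEq ?_ heq
      have h1 := ((contDiffAt_flowDeriv (hw.contDiffAt _ (hmap hy)) k).differentiableAt
        (by simp)).hasDerivAt
      have h2 := h1.comp y (hψ y hy)
      rw [mul_comm] at h2
      exact h2
  have hsm : ContDiffOn ℝ ∞ ψ t := by
    refine contDiffOn_of_differentiableOn_deriv fun k _ => ?_
    refine DifferentiableOn.congr (f := iteratedDeriv k ψ)
      (fun y hy => (hder k y hy).differentiableAt.differentiableWithinAt) ?_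
    exact fun y hy => iteratedDerivWithin_of_isOpen ht hy
  -- `D` is needed only at order zero; for higher orders the flow derivatives are used with `j = 0`,
  -- where the binomial coefficient is 1.
  refine of_bounds hm (fun y hy => hsm.contDiffAt (ht.mem_nhds hy)) (A := max D A)
    (B := 2 * A * B) (fun k y hy => ?_) (by positivity)
  rcases k with _ | k
  · simpa [hm.zero] using Or.inl (hD y hy)
  · rw [iteratedDeriv_succ, (hder k y hy).deriv]
    have h1 := norm_iteratedDeriv_flowDeriv_le hm hw (by linarith) (by linarith) H (hmap hy) k 0
    simp only [iteratedDeriv_zero, Nat.factorial_zero, Nat.cast_one, one_mul, add_zero,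
      Nat.choose_zero_right, mul_one] at h1
    have h2 : m k ≤ m (k + 1) := hm.mono (Nat.le_succ k)
    have h3 : (k ! : ℝ) ≤ ((k + 1)! : ℝ) := by exact_mod_cast Nat.factorial_le (Nat.le_succ k)
    have h4 : (1 : ℝ) ≤ max D A := hA.trans (le_max_right _ _)
    have hmp := (hm.pos k).le
    calc _ ≤ _ := h1
      _ = (k ! : ℝ) * 1 * (A ^ (k + 1) * B ^ k * 2 ^ k) * m k := by ring
      _ ≤ ((k + 1)! : ℝ) * max D A * (A ^ (k + 1) * B ^ (k + 1) * 2 ^ (k + 1)) * m (k + 1) := by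
          gcongr
          · omega
          · norm_num
          · omega
      _ = _ := by rw [mul_pow, mul_pow]; ring

end

/-! ### Germs in several variables and their restrictions to the axes -/

section

variable {m : ℕ → ℝ} {n : ℕ}

lemma iteratedFDeriv_comp_clm_apply {E G : Type*} [NormedAddCommGroup E] [NormedSpace ℝ E]
    [NormedAddCommGroup G] [NormedSpace ℝ G] {f : G → ℂ} {U : Set G} (hU : IsOpen U)
    (hf : ContDiffOn ℝ ∞ f U) (L : E →L[ℝ] G) {x : E} (hx : L x ∈ U) (k : ℕ) (v : Fin k → E) :
    iteratedFDeriv ℝ k (fun y => f (L y)) x v = iteratedFDeriv ℝ k f (L x) (fun j => L (v j)) := by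
  have hV : IsOpen (L ⁻¹' U) := hU.preimage L.continuous
  have h := L.iteratedFDerivWithin_comp_right hf hU.uniqueDiffOn hV.uniqueDiffOn hx
    (i := k) (by exact_mod_cast le_top)
  rw [iteratedFDerivWithin_of_isOpen k hV hx, iteratedFDerivWithin_of_isOpen k hU hx] at h
  exact congrArg (fun M => M v) h

/-- A mixed partial of a function of one coordinate is its derivative of order `|α|` times a product
of coordinates of unit vectors, each 0 or 1. -/
lemma inRing_comp_proj {p : ℝ → ℂ} {s : Set ℝ} (hs : IsOpen s) (h0 : (0 : ℝ) ∈ s)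
    (hp : DCOn m s p) (i : Fin n) : InRing m (fun x : Fin n → ℝ => p (x i)) := by
  set L : (Fin n → ℝ) →L[ℝ] ℝ := ContinuousLinearMap.proj i
  have hon : ContDiffOn ℝ ∞ p s := fun x hx => (hp.contDiffAt x hx).contDiffWithinAt
  obtain ⟨A, B, hA, hB, H⟩ := hp.bound
  refine ⟨L ⁻¹' s, hs.preimage L.continuous, h0, ?_, A, B, hA, hB, fun x hx α => ?_⟩
  · exact hon.comp L.contDiff.contDiffOn (mapsTo_preimage _ _)
  · refine le_trans ?_ (H (∑ i, α i) (x i) hx)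
    have := iteratedFDeriv_comp_clm_apply hs hon L hx (∑ i, α i)
      (fun j => Pi.single (finSigmaFinEquiv.symm j).1 (1 : ℝ))
    rw [partialDeriv]
    change ‖iteratedFDeriv ℝ _ (fun y => p (L y)) x _‖ ≤ _
    rw [this, iteratedFDeriv_apply_eq_iteratedDeriv_mul_prod, norm_smul, norm_prod]
    refine mul_le_of_le_one_left (norm_nonneg _) (Finset.prod_le_one (fun _ _ => norm_nonneg _) ?_)
    intro j _
    change ‖(Pi.single (finSigmaFinEquiv.symm j).1 (1 : ℝ) : Fin n → ℝ) i‖ ≤ 1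
    by_cases h : i = (finSigmaFinEquiv.symm j).1
    · rw [← h, Pi.single_eq_same]; simp
    · rw [Pi.single_eq_of_ne h]; simp

lemma InRing.sub (hm : IsWeight m) {f g : (Fin n → ℝ) → ℂ} (hf : InRing m f) (hg : InRing m g) :
    InRing m (fun x => f x - g x) := by
  obtain ⟨U, hU, h0, hfc, A, B, hA, hB, H⟩ := hf
  obtain ⟨V, hV, h0', hgc, A', B', hA', hB', H'⟩ := hg
  refine ⟨U ∩ V, hU.inter hV, ⟨h0, h0'⟩,
    (hfc.mono inter_subset_left).sub (hgc.mono inter_subset_right),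
    A + A', max B B', by positivity, by positivity, fun x hx α => ?_⟩
  have h1 : partialDeriv α (fun x => f x - g x) x = partialDeriv α f x - partialDeriv α g x := by
    have hle : ((∑ i, α i : ℕ) : WithTop ℕ∞) ≤ ∞ := by exact_mod_cast le_top
    have := iteratedFDeriv_sub_apply ((hfc.contDiffAt (hU.mem_nhds hx.1)).of_le hle)
      ((hgc.contDiffAt (hV.mem_nhds hx.2)).of_le hle)
    exact congrArg (fun M => M (fun j => Pi.single (finSigmaFinEquiv.symm j).1 (1 : ℝ))) this
  have := (hm.pos (∑ i, α i)).le
  rw [h1]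
  set k := ∑ i, α i
  calc _ ≤ (k ! : ℝ) * A * B ^ k * m k + (k ! : ℝ) * A' * B' ^ k * m k :=
        (norm_sub_le _ _).trans (add_le_add (H x hx.1 α) (H' x hx.2 α))
    _ ≤ (k ! : ℝ) * A * (max B B') ^ k * m k + (k ! : ℝ) * A' * (max B B') ^ k * m k := by
        gcongr
        · exact le_max_left _ _
        · exact le_max_right _ _
    _ = _ := by ring

lemma InRing.contDiffAt {f : (Fin n → ℝ) → ℂ} (hf : InRing m f) : ContDiffAt ℝ ∞ f 0 := by
  obtain ⟨U, hU, h0, hfc, -⟩ := hf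
  exact hfc.contDiffAt (hU.mem_nhds h0)

lemma iteratedFDeriv_const_apply_congr {f : (Fin n → ℝ) → ℂ} {x v : Fin n → ℝ} {k l : ℕ}
    (h : k = l) : iteratedFDeriv ℝ k f x (fun _ => v) = iteratedFDeriv ℝ l f x (fun _ => v) := by
  subst h; rfl

lemma partialDeriv_single {U : Set (Fin n → ℝ)} (hU : IsOpen U) {f : (Fin n → ℝ) → ℂ}
    (hf : ContDiffOn ℝ ∞ f U) (i : Fin n) (k : ℕ) {t : ℝ} (ht : Pi.single i t ∈ U) :
    partialDeriv (Pi.single i k) f (Pi.single i t) =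
      iteratedDeriv k (fun t : ℝ => f (Pi.single i t)) t := by
  set L : ℝ →L[ℝ] (Fin n → ℝ) := ContinuousLinearMap.single ℝ (fun _ => ℝ) i
  have h1 : iteratedDeriv k (fun t : ℝ => f (Pi.single i t)) t =
      iteratedFDeriv ℝ k f (Pi.single i t) (fun _ => Pi.single i 1) := by
    rw [iteratedDeriv_eq_iteratedFDeriv]
    exact iteratedFDeriv_comp_clm_apply hU hf L ht k _
  have h2 : (fun j : Fin (∑ l, (Pi.single i k : Fin n → ℕ) l) =>
      (Pi.single (finSigmaFinEquiv.symm j).1 (1 : ℝ) : Fin n → ℝ)) = fun _ => Pi.single i 1 := by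
    funext j
    have : (finSigmaFinEquiv.symm j).1 = i := by
      -- The index has the form `⟨i', l⟩` with `l < Pi.single i k i'`, which is impossible for `i' ≠
      -- i`.
      by_contra hne
      have := (finSigmaFinEquiv.symm j).2.2
      exact absurd this (by simp [Pi.single_eq_of_ne hne])
    rw [this]
  rw [h1, partialDeriv, h2]
  exact iteratedFDeriv_const_apply_congr (by simp)

lemma InRing.exists_dcOn {f : (Fin n → ℝ) → ℂ} (hf : InRing m f) (i : Fin n) :
    ∃ δ : ℝ, 0 < δ ∧ DCOn m (Ioo (-δ) δ) (fun t : ℝ => f (Pi.single i t)) := by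
  obtain ⟨U, hU, h0, hfc, A, B, hA, hB, H⟩ := hf
  have hc : Continuous fun t : ℝ => (Pi.single i t : Fin n → ℝ) :=
    (ContinuousLinearMap.single ℝ (fun _ => ℝ) i).continuous
  have hmem : (fun t : ℝ => (Pi.single i t : Fin n → ℝ)) ⁻¹' U ∈ 𝓝 (0 : ℝ) :=
    (hU.preimage hc).mem_nhds (by simpa using h0)
  obtain ⟨δ, hδ, hball⟩ := Metric.mem_nhds_iff.1 hmem
  rw [Real.ball_eq_Ioo, zero_sub, zero_add] at hball
  refine ⟨δ, hδ, fun t ht => ?_, A, B, hA, hB, fun k t ht => ?_⟩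
  · exact (hfc.contDiffAt (hU.mem_nhds (hball ht))).comp t
      (ContinuousLinearMap.single ℝ (fun _ => ℝ) i).contDiff.contDiffAt
  · rw [← partialDeriv_single hU hfc i k (hball ht)]
    have := H _ (hball ht) (Pi.single i k)
    rwa [show ∑ l, (Pi.single i k : Fin n → ℕ) l = k by simp] at this

lemma taylor_coeff_fin_one {f : (Fin 1 → ℝ) → ℂ} (hf : InRing m f) (α : Fin 1 →₀ ℕ) :
    taylor f α = iteratedDeriv (α 0) (fun t : ℝ => f (fun _ => t)) 0 / ((α 0)! : ℂ) := by
  obtain ⟨U, hU, h0, hfc, -⟩ := hf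
  have h1 := partialDeriv_single hU hfc 0 (α 0) (t := 0) (by simpa using h0)
  have h2 : (Pi.single 0 (α 0) : Fin 1 → ℕ) = fun i => α i := by
    funext i; rw [Subsingleton.elim i 0]; simp
  have h3 : ∀ t : ℝ, (Pi.single 0 t : Fin 1 → ℝ) = fun _ => t := fun t => by
    funext i; rw [Subsingleton.elim i 0]; simp
  rw [h2] at h1
  simp only [Pi.single_zero] at h1
  simp only [h3] at h1
  simp [taylor, h1]

lemma taylor_fin_one_eq_iff {m' : ℕ → ℝ} {f g : (Fin 1 → ℝ) → ℂ} (hf : InRing m f)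
    (hg : InRing m' g) :
    taylor f = taylor g ↔ ∀ k, iteratedDeriv k (fun t : ℝ => f (fun _ => t)) 0 =
      iteratedDeriv k (fun t : ℝ => g (fun _ => t)) 0 := by
  constructor
  · intro h k
    have h1 := congrFun h (Finsupp.single 0 k)
    rw [taylor_coeff_fin_one hf, taylor_coeff_fin_one hg] at h1
    simp only [Finsupp.single_eq_same] at h1
    have : ((k ! : ℕ) : ℂ) ≠ 0 := by exact_mod_cast Nat.factorial_ne_zero k
    exact (div_left_inj' this).1 h1
  · intro h
    funext α
    rw [taylor_coeff_fin_one hf, taylor_coeff_fin_one hg, h]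

end

/-! ### Divergence of the series implies quasi-analyticity (Bang's argument) -/

section Bang

variable {f : ℝ → ℂ} {M : ℕ → ℝ} {δ : ℝ}

lemma hasDerivAt_iteratedDeriv {x : ℝ} (hf : ContDiffAt ℝ ∞ f x) (n : ℕ) :
    HasDerivAt (iteratedDeriv n f) (iteratedDeriv (n + 1) f x) x := by
  rw [iteratedDeriv_succ]
  have h : ContDiffAt ℝ 1 (iteratedDeriv n f) x := by
    have h1 : ContDiffAt ℝ ((1 + n : ℕ) : WithTop ℕ∞) f x := hf.of_le (by exact_mod_cast le_top)
    have := h1.iteratedFDeriv_right (m := 1) (i := n) (by push_cast; rfl)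
    rw [iteratedDeriv_eq_equiv_comp]
    exact (LinearIsometryEquiv.contDiff _).contDiffAt.comp x this
  exact (h.differentiableAt one_ne_zero).hasDerivAt

/-- One step of Bang's argument: if all derivatives at `y` are small at level `N + 1`, they are
small at level `N` on an interval of length `M N / (e M (N + 1))`. -/
lemma bang_step (hM : ∀ n, 0 < M n) (hmono : Monotone fun n => M (n + 1) / M n)
    {y h : ℝ} (hh : 0 ≤ h) (hf : ∀ x ∈ Icc y (y + h), ContDiffAt ℝ ∞ f x)
    (hb : ∀ n, ∀ x ∈ Icc y (y + h), ‖iteratedDeriv n f x‖ ≤ M n) (N : ℕ)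
    (hy : ∀ n : ℕ, ‖iteratedDeriv n f y‖ ≤ Real.exp ((n : ℝ) - (N + 1)) * M n)
    (hstep : h * (Real.exp 1 * (M (N + 1) / M N)) ≤ 1) (n : ℕ) :
    ‖iteratedDeriv n f (y + h)‖ ≤ Real.exp ((n : ℝ) - N) * M n := by
  set R := M (N + 1) / M N with hR
  have hR0 : 0 < R := div_pos (hM _) (hM _)
  rcases lt_or_ge N n with hn | hn
  · refine (hb n _ ⟨by linarith, le_rfl⟩).trans (le_mul_of_one_le_left (hM n).le ?_)
    rw [Real.one_le_exp_iff]
    have : (N : ℝ) ≤ n := by exact_mod_cast hn.le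
    linarith
  -- Descending induction on the order, from `N + 1` down: since the ratios of `M` up to order `N`
  -- are at most `R`, the bound on order `n + 1` makes the exponential majorant of order `n` grow at
  -- least as fast as the derivative.
  have key : ∀ j n : ℕ, n + j = N + 1 → ∀ x ∈ Icc y (y + h), ‖iteratedDeriv n f x‖ ≤
      Real.exp ((n : ℝ) - (N + 1)) * M n * Real.exp (Real.exp 1 * R * (x - y)) := by
    intro j
    induction j with
    | zero =>
      rintro n hn x hx
      obtain rfl : n = N + 1 := by omega
      refine (hb _ x hx).trans ?_
      have h1 : 1 ≤ Real.exp (Real.exp 1 * R * (x - y)) := by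
        rw [Real.one_le_exp_iff]
        have : 0 ≤ x - y := by linarith [hx.1]
        positivity
      have := (hM (N + 1)).le
      push_cast
      rw [sub_self, Real.exp_zero, one_mul]
      exact le_mul_of_one_le_right this h1
    | succ j ih =>
      intro n hn
      have ih' := ih (n + 1) (by omega)
      have hder : ∀ x, HasDerivAt
          (fun x => Real.exp ((n : ℝ) - (N + 1)) * M n * Real.exp (Real.exp 1 * R * (x - y)))
          (Real.exp ((n : ℝ) - (N + 1)) * M n *
            (Real.exp (Real.exp 1 * R * (x - y)) * (Real.exp 1 * R * 1))) x := fun x =>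
        ((((hasDerivAt_id x).sub_const y).const_mul (Real.exp 1 * R)).exp).const_mul _
      refine image_norm_le_of_norm_deriv_right_le_deriv_boundary
        (f' := iteratedDeriv (n + 1) f)
        (fun x hx => (hasDerivAt_iteratedDeriv (hf x hx) n).continuousAt.continuousWithinAt)
        (fun x hx => (hasDerivAt_iteratedDeriv (hf x (Ico_subset_Icc_self hx)) n).hasDerivWithinAt)
        (by simpa using hy n) hder (fun x hx => ?_)
      refine (ih' x (Ico_subset_Icc_self hx)).trans ?_
      have h1 : M (n + 1) ≤ R * M n := by
        have : M (n + 1) / M n ≤ R := hmono (show n ≤ N by omega)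
        rwa [div_le_iff₀ (hM n)] at this
      have h2 : Real.exp (((n + 1 : ℕ) : ℝ) - (N + 1)) = Real.exp ((n : ℝ) - (N + 1)) * Real.exp 1 := by
        rw [← Real.exp_add]; push_cast; ring_nf
      rw [h2]
      calc _ ≤ Real.exp ((n : ℝ) - (N + 1)) * Real.exp 1 * (R * M n)
            * Real.exp (Real.exp 1 * R * (x - y)) := by gcongr
        _ = _ := by ring
  refine (key (N + 1 - n) n (by omega) (y + h) ⟨by linarith, le_rfl⟩).trans ?_
  have h3 : Real.exp (Real.exp 1 * R * (y + h - y)) ≤ Real.exp 1 := by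
    rw [Real.exp_le_exp]; linarith [hstep]
  have h4 : Real.exp ((n : ℝ) - N) = Real.exp ((n : ℝ) - (N + 1)) * Real.exp 1 := by
    rw [← Real.exp_add]; ring_nf
  have := (hM n).le
  rw [h4]
  calc _ ≤ Real.exp ((n : ℝ) - (N + 1)) * M n * Real.exp 1 := by gcongr
    _ = _ := by ring

/-- At the origin all derivatives vanish, so the bounds hold at every level. Moving right by `a N`
costs one level, from `N + 1` to `N`. As the `a n` are not summable, each point is reached from 0
with any prescribed final level `N`, giving `‖f x‖ ≤ exp (-N) * M 0` for all `N`. -/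
lemma eq_zero_of_flat_right (hM : ∀ n, 0 < M n) (hmono : Monotone fun n => M (n + 1) / M n)
    (hdiv : ¬ Summable fun n => M n / M (n + 1))
    (hf : ∀ x ∈ Ico 0 δ, ContDiffAt ℝ ∞ f x)
    (hb : ∀ n, ∀ x ∈ Ico 0 δ, ‖iteratedDeriv n f x‖ ≤ M n)
    (hflat : ∀ n, iteratedDeriv n f 0 = 0) {x : ℝ} (hx : x ∈ Ico 0 δ) : f x = 0 := by
  set a : ℕ → ℝ := fun n => (Real.exp 1)⁻¹ * (M n / M (n + 1)) with ha
  have ha0 : ∀ n, 0 < a n := fun n => mul_pos (by positivity) (div_pos (hM _) (hM _))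
  have hQ : ∀ p N : ℕ, ∀ x ∈ Ico 0 δ, x ≤ ∑ j ∈ Finset.range p, a (N + j) → ∀ n : ℕ,
      ‖iteratedDeriv n f x‖ ≤ Real.exp ((n : ℝ) - N) * M n := by
    intro p
    induction p with
    | zero =>
      intro N x hx hxs n
      obtain rfl : x = 0 := le_antisymm (by simpa using hxs) hx.1
      rw [hflat, norm_zero]
      exact mul_nonneg (Real.exp_pos _).le (hM n).le
    | succ p ih =>
      intro N x hx hxs n
      -- The point one step to the left of `x`, truncated at 0 to stay in the domain.
      have hy0 : 0 ≤ max 0 (x - a N) := le_max_left _ _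
      have hyx : max 0 (x - a N) ≤ x := max_le hx.1 (by linarith [ha0 N])
      have hys : max 0 (x - a N) ≤ ∑ j ∈ Finset.range p, a (N + 1 + j) := by
        refine max_le (Finset.sum_nonneg fun j _ => (ha0 _).le) ?_
        rw [Finset.sum_range_succ'] at hxs
        simp only [add_zero] at hxs
        have : ∑ j ∈ Finset.range p, a (N + (j + 1)) = ∑ j ∈ Finset.range p, a (N + 1 + j) :=
          Finset.sum_congr rfl fun j _ => by rw [show N + (j + 1) = N + 1 + j by ring]
        linarith
      have hsub : ∀ z ∈ Icc (max 0 (x - a N)) (max 0 (x - a N) + (x - max 0 (x - a N))),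
          z ∈ Ico 0 δ := fun z hz =>
        ⟨hy0.trans hz.1, lt_of_le_of_lt (hz.2.trans_eq (by ring)) hx.2⟩
      have hN := ih (N + 1) _ ⟨hy0, hyx.trans_lt hx.2⟩ hys
      have := bang_step hM hmono (y := max 0 (x - a N)) (h := x - max 0 (x - a N)) (by linarith)
        (fun z hz => hf z (hsub z hz)) (fun n z hz => hb n z (hsub z hz)) N
        (by simpa using hN) ?_ n
      · simpa using this
      · have h1 : x - max 0 (x - a N) ≤ a N := by linarith [le_max_right 0 (x - a N)]
        have hp : 0 < Real.exp 1 * (M (N + 1) / M N) :=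
          mul_pos (Real.exp_pos 1) (div_pos (hM _) (hM _))
        calc _ ≤ a N * (Real.exp 1 * (M (N + 1) / M N)) := by gcongr
          _ = 1 := by
            have := (hM N).ne'
            have := (hM (N + 1)).ne'
            simp only [ha]; field_simp
  have hbound : ∀ N : ℕ, ‖f x‖ ≤ Real.exp (-(N : ℝ)) * M 0 := by
    intro N
    have hns : ¬ Summable fun j => a (N + j) := by
      intro hs
      apply hdiv
      have h1 : Summable a := by
        rw [← summable_nat_add_iff N]
        simpa [add_comm] using hs
      have h2 := h1.mul_left (Real.exp 1)
      refine h2.congr fun n => ?_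
      have := (Real.exp_pos 1).ne'
      simp only [ha]; field_simp
    rw [not_summable_iff_tendsto_nat_atTop_of_nonneg (fun j => (ha0 _).le)] at hns
    obtain ⟨p, hp⟩ := (hns.eventually_ge_atTop x).exists
    simpa using hQ p N x hx hp 0
  have hlim : Tendsto (fun N : ℕ => Real.exp (-(N : ℝ)) * M 0) atTop (𝓝 (0 * M 0)) :=
    (Real.tendsto_exp_neg_atTop_nhds_zero.comp tendsto_natCast_atTop_atTop).mul_const _
  rw [zero_mul] at hlim
  exact norm_le_zero_iff.1 (ge_of_tendsto' hlim hbound)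

end Bang

/-- The sufficient condition of the Denjoy–Carleman theorem, for functions of one variable. -/
lemma DCOn.eq_zero_of_flat {m : ℕ → ℝ} (hm : IsWeight m)
    (hdiv : ¬ Summable fun j : ℕ => m j / ((j + 1) * m (j + 1))) {δ : ℝ} {f : ℝ → ℂ}
    (hf : DCOn m (Ioo (-δ) δ) f) (hflat : ∀ n, iteratedDeriv n f 0 = 0) {x : ℝ}
    (hx : x ∈ Ioo (-δ) δ) : f x = 0 := by
  obtain ⟨A, B, hA, hB, H⟩ := hf.bound
  have hδ : 0 < δ := by linarith [hx.1, hx.2]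
  set M : ℕ → ℝ := fun n => (n ! : ℝ) * A * B ^ n * m n with hMdef
  have hM : ∀ n, 0 < M n := fun n => by have := hm.pos n; positivity
  have hratio : ∀ n, M (n + 1) / M n = (n + 1) * B * (m (n + 1) / m n) := fun n => by
    have h1 := (hm.pos n).ne'
    have h2 : (n ! : ℝ) ≠ 0 := by positivity
    simp only [hMdef, Nat.factorial_succ]
    push_cast
    field_simp
    ring
  have hmono : Monotone fun n => M (n + 1) / M n := by
    intro i j hij
    simp only [hratio]
    have h1 := hm.ratio_mono hij
    have h2 := (hm.ratio_pos i).le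
    simp only at h1
    gcongr
  have hdivM : ¬ Summable fun n => M n / M (n + 1) := by
    intro hs
    apply hdiv
    refine (hs.mul_left B).congr fun n => ?_
    rw [← inv_div, hratio]
    have h1 := (hm.pos n).ne'
    have h2 := (hm.pos (n + 1)).ne'
    have h3 : (n : ℝ) + 1 ≠ 0 := by positivity
    field_simp
  rcases le_total 0 x with h0 | h0
  · exact eq_zero_of_flat_right hM hmono hdivM
      (fun y hy => hf.contDiffAt y ⟨by linarith [hy.1], hy.2⟩)
      (fun n y hy => H n y ⟨by linarith [hy.1], hy.2⟩) hflat ⟨h0, hx.2⟩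
  -- The left half follows by reflection, which preserves the norms of all derivatives.
  · have hneg : ∀ n y, iteratedDeriv n (fun t => f (-t)) y = (-1 : ℝ) ^ n • iteratedDeriv n f (-y) :=
      fun n y => iteratedDeriv_comp_neg n f y
    have := eq_zero_of_flat_right (f := fun t => f (-t)) (δ := δ) hM hmono hdivM
      (fun y hy => ContDiffAt.comp y
        (hf.contDiffAt (-y) ⟨by linarith [hy.2], by linarith [hy.1]⟩) contDiffAt_id.neg)
      (fun n y hy => by
        rw [hneg, norm_smul, norm_pow, norm_neg, norm_one, one_pow, one_mul]
        exact H n (-y) ⟨by linarith [hy.2], by linarith [hy.1]⟩)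
      (fun n => by rw [hneg, neg_zero, hflat, smul_zero])
      (x := -x) ⟨by linarith, by linarith [hx.1]⟩
    simpa using this

lemma taylor_injective_fin_one {m : ℕ → ℝ} (hm : IsWeight m)
    (hdiv : ¬ Summable fun j : ℕ => m j / ((j + 1) * m (j + 1))) {f g : (Fin 1 → ℝ) → ℂ}
    (hf : InRing m f) (hg : InRing m g) (h : taylor f = taylor g) : f =ᶠ[𝓝 0] g := by
  have h3 : ∀ t : ℝ, (Pi.single 0 t : Fin 1 → ℝ) = fun _ => t := fun t => by
    funext i; rw [Subsingleton.elim i 0]; simp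
  obtain ⟨δ, hδ, hD⟩ := (hf.sub hm hg).exists_dcOn 0
  simp only [h3] at hD
  have hline : ∀ {u : (Fin 1 → ℝ) → ℂ}, InRing m u → ∀ k : ℕ,
      ContDiffAt ℝ k (fun t : ℝ => u (fun _ => t)) 0 := fun hu k => by
    obtain ⟨ε, hε, hE⟩ := hu.exists_dcOn 0
    simp only [h3] at hE
    exact hE.contDiffAt_nat ⟨by linarith, hε⟩ k
  have hflat : ∀ k, iteratedDeriv k (fun t : ℝ => f (fun _ => t) - g (fun _ => t)) 0 = 0 := fun k => by
    rw [iteratedDeriv_fun_sub (hline hf k) (hline hg k), (taylor_fin_one_eq_iff hf hg).1 h k, sub_self]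
  have hmem : ∀ᶠ x : Fin 1 → ℝ in 𝓝 0, x 0 ∈ Ioo (-δ) δ :=
    (continuous_apply 0).continuousAt.eventually (Ioo_mem_nhds (by simpa using hδ) (by simpa using hδ))
  filter_upwards [hmem] with x hx
  have := hD.eq_zero_of_flat hm hdiv hflat hx
  have hx' : (fun _ => x 0) = x := by funext i; rw [Subsingleton.elim i 0]
  rw [hx'] at this
  exact sub_eq_zero.1 this

/-! ### Convergence of the series produces a flat function (iterated averages) -/

/-- The mean value of `u` over `[x - a, x]`. -/
noncomputable def average (a : ℝ) (u : ℝ → ℝ) (x : ℝ) : ℝ := a⁻¹ * ∫ y in x - a..x, u y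

lemma average_sub_const_le {a : ℝ} (ha : 0 < a) {u : ℝ → ℝ} (hu : Continuous u) {x c ε : ℝ}
    (h : ∀ y ∈ Icc (x - a) x, |u y - c| ≤ ε) : |average a u x - c| ≤ ε := by
  have h1 : average a u x - c = a⁻¹ * ∫ y in x - a..x, (u y - c) := by
    rw [average, intervalIntegral.integral_sub (hu.intervalIntegrable _ _) (by simp)]
    simp only [intervalIntegral.integral_const, sub_sub_cancel, smul_eq_mul]
    field_simp
  have h2 : ‖∫ y in x - a..x, (u y - c)‖ ≤ ε * |x - (x - a)| := by
    refine intervalIntegral.norm_integral_le_of_norm_le_const fun y hy => ?_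
    rw [uIoc_of_le (by linarith)] at hy
    exact h y ⟨hy.1.le, hy.2⟩
  rw [h1, abs_mul, abs_of_pos (inv_pos.2 ha)]
  rw [sub_sub_cancel, abs_of_pos ha, Real.norm_eq_abs] at h2
  calc _ ≤ a⁻¹ * (ε * a) := by gcongr
    _ = ε := by field_simp

lemma average_sub_average_le {a : ℝ} (ha : 0 < a) {u v : ℝ → ℝ} (hu : Continuous u)
    (hv : Continuous v) {ε : ℝ} (h : ∀ y, |u y - v y| ≤ ε) (x : ℝ) :
    |average a u x - average a v x| ≤ ε := by
  have h1 : average a u x - average a v x = average a (fun y => u y - v y) x - 0 := by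
    simp only [average]
    rw [intervalIntegral.integral_sub (hu.intervalIntegrable _ _) (hv.intervalIntegrable _ _)]
    ring
  rw [h1]
  exact average_sub_const_le ha (hu.sub hv) fun y _ => by simpa using h y

lemma hasDerivAt_average (a : ℝ) {u : ℝ → ℝ} (hu : Continuous u) (x : ℝ) :
    HasDerivAt (average a u) (a⁻¹ * (u x - u (x - a))) x := by
  have h1 : average a u = fun x => a⁻¹ * ((∫ y in (0 : ℝ)..x, u y) - ∫ y in (0 : ℝ)..(x - a), u y) := by
    funext z
    rw [average, intervalIntegral.integral_interval_sub_left (hu.intervalIntegrable _ _)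
      (hu.intervalIntegrable _ _)]
  have hG : ∀ z, HasDerivAt (fun x => ∫ y in (0 : ℝ)..x, u y) (u z) z := fun z =>
    (hu.integral_hasStrictDerivAt 0 z).hasDerivAt
  rw [h1]
  have h2 : HasDerivAt (fun x => ∫ y in (0 : ℝ)..(x - a), u y) (u (x - a)) x := by
    have := (hG (x - a)).comp x ((hasDerivAt_id x).sub_const a)
    rw [mul_one] at this
    exact this
  exact ((hG x).sub h2).const_mul _

/-- The averages over the lengths `a k, …, a (k + N - 1)` of the ramp function. -/
noncomputable def iterAverage (a : ℕ → ℝ) : ℕ → ℕ → ℝ → ℝ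
  | 0, _ => fun x => min (max x 0) 1
  | N + 1, k => average (a k) (iterAverage a N (k + 1))

section

variable {a : ℕ → ℝ}

lemma continuous_iterAverage (N k : ℕ) : Continuous (iterAverage a N k) := by
  induction N generalizing k with
  | zero => exact (continuous_id.max continuous_const).min continuous_const
  | succ N ih =>
    exact continuous_iff_continuousAt.2 fun x =>
      (hasDerivAt_average (a k) (ih (k + 1)) x).continuousAt

lemma abs_iterAverage_le (ha : ∀ j, 0 < a j) (N k : ℕ) (x : ℝ) : |iterAverage a N k x| ≤ 1 := by
  induction N generalizing k x with
  | zero =>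
    rw [iterAverage, abs_le]
    exact ⟨by linarith [le_min (le_max_right x 0) zero_le_one], min_le_right _ _⟩
  | succ N ih =>
    have := average_sub_const_le (ha k) (continuous_iterAverage N (k + 1)) (x := x) (c := 0)
      (ε := 1) fun y _ => by simpa using ih (k + 1) y
    simpa [iterAverage] using this

lemma iterAverage_eq_zero (ha : ∀ j, 0 < a j) (N k : ℕ) {x : ℝ} (hx : x ≤ 0) :
    iterAverage a N k x = 0 := by
  induction N generalizing k x with
  | zero => simp [iterAverage, hx]
  | succ N ih =>
    have := average_sub_const_le (ha k) (continuous_iterAverage N (k + 1)) (x := x) (c := 0)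
      (ε := 0) fun y hy => by rw [ih (k + 1) (hy.2.trans hx)]; simp
    simpa [iterAverage] using this

/-- The ramp is 1-Lipschitz, so the innermost average moves it by at most its length; the outer
averages do not increase the sup distance. -/
lemma abs_iterAverage_succ_sub_le (ha : ∀ j, 0 < a j) (N k : ℕ) (x : ℝ) :
    |iterAverage a (N + 1) k x - iterAverage a N k x| ≤ a (k + N) := by
  induction N generalizing k x with
  | zero =>
    refine average_sub_const_le (ha k) (continuous_iterAverage 0 (k + 1)) fun y hy => ?_
    simp only [iterAverage]
    refine (abs_min_sub_min_le_max _ _ _ _).trans ?_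
    simp only [sub_self, abs_zero]
    refine max_le ((abs_max_sub_max_le_max _ _ _ _).trans ?_) (ha _).le
    simp only [sub_self, abs_zero]
    refine max_le ?_ (ha _).le
    rw [abs_le]; constructor <;> simp only [add_zero] <;> linarith [hy.1, hy.2, ha k]
  | succ N ih =>
    have := average_sub_average_le (ha k) (continuous_iterAverage (N + 1) (k + 1))
      (continuous_iterAverage N (k + 1)) (ih (k + 1)) x
    rw [show k + (N + 1) = k + 1 + N by ring]
    exact this

/-- Infinitely many successive averages of the ramp function over intervals of summable lengths:
a family of functions each of which is an average of the next one. -/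
lemma exists_average_tower (ha : ∀ j, 0 < a j) (hs : Summable a) :
    ∃ V : ℕ → ℝ → ℝ, (∀ k, Continuous (V k)) ∧ (∀ k, V k = average (a k) (V (k + 1))) ∧
      (∀ k x, |V k x| ≤ 1) ∧ (∀ k, ∀ x ≤ 0, V k x = 0) ∧
      ∀ x, |V 0 x - min (max x 0) 1| ≤ ∑' j, a j := by
  have hsk : ∀ k, Summable fun N => a (k + N) := fun k => by
    simpa [add_comm] using (summable_nat_add_iff k).2 hs
  have hdist : ∀ k x N, dist (iterAverage a N k x) (iterAverage a (N + 1) k x) ≤ a (k + N) :=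
    fun k x N => by
      rw [dist_comm, Real.dist_eq]; exact abs_iterAverage_succ_sub_le ha N k x
  have hlim : ∀ k x, ∃ l, Tendsto (fun N => iterAverage a N k x) atTop (𝓝 l) := fun k x =>
    cauchySeq_tendsto_of_complete (cauchySeq_of_dist_le_of_summable _ (hdist k x) (hsk k))
  choose V hV using hlim
  have htail : ∀ k N x, |iterAverage a N k x - V k x| ≤ ∑' j, a (k + (N + j)) := fun k N x =>
    dist_le_tsum_of_dist_le_of_tendsto _ (hdist k x) (hsk k) (hV k x) N
  have htend : ∀ k, Tendsto (fun N => ∑' j, a (k + (N + j))) atTop (𝓝 0) := fun k => by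
    have := tendsto_sum_nat_add (fun j => a (k + j))
    refine this.congr fun N => tsum_congr fun j => ?_
    rw [add_comm j N]
  have hcont : ∀ k, Continuous (V k) := fun k => by
    have hu : TendstoUniformly (fun N => iterAverage a N k) (V k) atTop := by
      rw [Metric.tendstoUniformly_iff]
      intro ε hε
      filter_upwards [(htend k).eventually_lt_const hε] with N hN x
      rw [dist_comm, Real.dist_eq]
      exact (htail k N x).trans_lt hN
    exact hu.continuous (Frequently.of_forall fun N => continuous_iterAverage N k)
  refine ⟨V, hcont, fun k => ?_, fun k x => ?_, fun k x hx => ?_, fun x => ?_⟩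
  · funext x
    have h1 : Tendsto (fun N => iterAverage a (N + 1) k x) atTop (𝓝 (V k x)) :=
      (hV k x).comp (tendsto_add_atTop_nat 1)
    refine tendsto_nhds_unique h1 ?_
    rw [tendsto_iff_dist_tendsto_zero]
    refine squeeze_zero (fun _ => dist_nonneg) (fun N => ?_) (htend (k + 1))
    rw [Real.dist_eq]
    exact average_sub_average_le (ha k) (continuous_iterAverage N (k + 1)) (hcont (k + 1))
      (htail (k + 1) N) x
  · exact le_of_tendsto' (hV k x).abs fun N => abs_iterAverage_le ha N k x
  · exact tendsto_nhds_unique (hV k x)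
      (by simp [iterAverage_eq_zero ha _ k hx])
  · have := htail 0 0 x
    simp only [zero_add] at this
    rw [abs_sub_comm]
    exact this

/-- The derivative of `V k` is a difference quotient of `V (k + 1)`, so smoothness climbs one order
at each level. -/
lemma tower_contDiff {V : ℕ → ℝ → ℝ} (hc : ∀ k, Continuous (V k))
    (hV : ∀ k, V k = average (a k) (V (k + 1))) (n k : ℕ) : ContDiff ℝ n (V k) := by
  have hder : ∀ k x, HasDerivAt (V k) ((a k)⁻¹ * (V (k + 1) x - V (k + 1) (x - a k))) x :=
    fun k x => by
      have := hasDerivAt_average (a k) (hc (k + 1)) x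
      rwa [← hV k] at this
  induction n generalizing k with
  | zero => exact_mod_cast contDiff_zero.2 (hc k)
  | succ n ih =>
    push_cast
    rw [contDiff_succ_iff_deriv]
    refine ⟨fun x => (hder k x).differentiableAt, by simp, ?_⟩
    rw [show deriv (V k) = fun x => (a k)⁻¹ * (V (k + 1) x - V (k + 1) (x - a k)) from
      funext fun x => (hder k x).deriv]
    exact contDiff_const.mul ((ih (k + 1)).sub ((ih (k + 1)).comp (contDiff_id.sub contDiff_const)))

/-- Each differentiation replaces `V k` by a difference of two values of `V (k + 1)` divided by `a
k`. -/
lemma tower_iteratedDeriv_le (ha : ∀ j, 0 < a j) {V : ℕ → ℝ → ℝ} (hc : ∀ k, Continuous (V k))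
    (hV : ∀ k, V k = average (a k) (V (k + 1))) (hb : ∀ k x, |V k x| ≤ 1) (n k : ℕ) (x : ℝ) :
    ‖iteratedDeriv n (V k) x‖ ≤ ∏ i ∈ Finset.range n, 2 / a (k + i) := by
  induction n generalizing k x with
  | zero => simpa using hb k x
  | succ n ih =>
    have hd : deriv (V k) = fun x => (a k)⁻¹ * (V (k + 1) x - V (k + 1) (x - a k)) := by
      funext x
      have := hasDerivAt_average (a k) (hc (k + 1)) x
      rw [← hV k] at this
      exact this.deriv
    have hcd := tower_contDiff hc hV n (k + 1)
    have hcd' : ContDiff ℝ n fun x => V (k + 1) (x - a k) :=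
      hcd.comp (contDiff_id.sub contDiff_const)
    rw [iteratedDeriv_succ', hd, iteratedDeriv_const_mul_field,
      iteratedDeriv_fun_sub hcd.contDiffAt hcd'.contDiffAt, iteratedDeriv_comp_sub_const,
      norm_mul, norm_inv, Real.norm_eq_abs (a k), abs_of_pos (ha k), Finset.prod_range_succ']
    have h1 := ih (k + 1) x
    have h2 := ih (k + 1) (x - a k)
    have h3 : ∀ i, k + 1 + i = k + (i + 1) := fun i => by ring
    simp only [h3] at h1 h2
    have := ha k
    calc _ ≤ (a k)⁻¹ * (∏ i ∈ Finset.range n, 2 / a (k + (i + 1))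
          + ∏ i ∈ Finset.range n, 2 / a (k + (i + 1))) := by
          gcongr; exact (norm_sub_le _ _).trans (add_le_add h1 h2)
      _ = _ := by rw [add_zero]; field_simp; ring

end

/-- If the Denjoy–Carleman series converges, the class contains a function that is flat at the
origin without vanishing near it. -/
lemma exists_flat {m : ℕ → ℝ} (hm : IsWeight m)
    (hs : Summable fun j : ℕ => m j / ((j + 1) * m (j + 1))) :
    ∃ f : ℝ → ℂ, DCOn m univ f ∧ (∀ t > 0, f t = 0) ∧ ¬ ∀ᶠ t in 𝓝 0, f t = 0 := by
  set b : ℕ → ℝ := fun j => m j / ((j + 1) * m (j + 1)) with hb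
  have hb0 : ∀ j, 0 < b j := fun j => by
    have := hm.pos j; have := hm.pos (j + 1); positivity
  set S := ∑' j, b j with hS
  have hS0 : 0 ≤ S := tsum_nonneg fun j => (hb0 j).le
  -- This scaling keeps the total averaging length at most `1/2`, so `V 0` stays nonzero at 1, where
  -- the ramp equals 1.
  set c : ℝ := (2 * (S + 1))⁻¹ with hc
  have hc0 : 0 < c := by positivity
  set a : ℕ → ℝ := fun j => c * b j with ha
  have ha0 : ∀ j, 0 < a j := fun j => mul_pos hc0 (hb0 j)
  obtain ⟨V, hVc, hVa, hVb, hV0, hV1⟩ := exists_average_tower ha0 (hs.mul_left c)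
  have hsum : ∑' j, a j ≤ 1 / 2 := by
    rw [tsum_mul_left, ← hS, hc]
    rw [inv_mul_le_iff₀ (by positivity)]; linarith
  have hVpos : V 0 1 ≠ 0 := fun h => by
    have := hV1 1
    rw [h] at this
    norm_num at this
    linarith
  set Z : Set ℝ := {x | V 0 x ≠ 0} with hZ
  have hZne : Z.Nonempty := ⟨1, hVpos⟩
  have hZb : BddBelow Z := ⟨0, fun x hx => by
    by_contra hlt
    exact hx (hV0 0 x (not_le.1 hlt).le)⟩
  -- The left edge of the set where `V 0` is nonzero: reflected about it, the function vanishes for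
  -- `t > 0` but not in any neighbourhood of 0.
  set t₀ := sInf Z with ht₀
  have hsm : ContDiff ℝ ∞ (V 0) := contDiff_infty.2 fun n => tower_contDiff hVc hVa n 0
  -- The product telescopes because `2 / a i = (2 / c) * (i + 1) * m (i + 1) / m i`.
  have hprod : ∀ n, ∏ i ∈ Finset.range n, 2 / a (0 + i) = (n ! : ℝ) * (2 / c) ^ n * m n := by
    intro n
    induction n with
    | zero => simp [hm.zero]
    | succ n ih =>
      have h1 := (hm.pos n).ne'
      have h2 := (hm.pos (n + 1)).ne'
      rw [Finset.prod_range_succ, ih, Nat.factorial_succ]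
      simp only [ha, hb, zero_add]
      push_cast
      rw [pow_succ]
      field_simp
  have hR : DCOn m univ (fun t => V 0 (t₀ - t)) := by
    refine DCOn.of_bounds hm (fun x _ => (hsm.comp (contDiff_const.sub contDiff_id)).contDiffAt)
      (A := 1) (B := 2 / c) (fun k x _ => ?_) (by positivity)
    have h1 : iteratedDeriv k (fun t => V 0 (t₀ - t)) x = (-1 : ℝ) ^ k • iteratedDeriv k (V 0) (t₀ - x) := by
      rw [iteratedDeriv_comp_const_sub]
    rw [h1, norm_smul, norm_pow, norm_neg, norm_one, one_pow, one_mul, mul_one, ← hprod]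
    exact tower_iteratedDeriv_le ha0 hVc hVa hVb k 0 _
  refine ⟨fun t => Complex.ofRealCLM (V 0 (t₀ - t)), hR.clm Complex.ofRealCLM hm, fun t ht => ?_, ?_⟩
  · have : t₀ - t ∉ Z := notMem_of_lt_csInf (by linarith) hZb
    have : V 0 (t₀ - t) = 0 := by simpa [hZ] using this
    simp [this]
  · intro hev
    obtain ⟨ε, hε, hball⟩ := Metric.eventually_nhds_iff.1 hev
    obtain ⟨x, hx, hxt⟩ := exists_lt_of_csInf_lt hZne (show sInf Z < t₀ + ε by linarith)
    have hx0 : t₀ ≤ x := csInf_le hZb hx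
    have := hball (y := t₀ - x) (by rw [Real.dist_eq, abs_lt]; constructor <;> linarith)
    simp at this
    exact hx this

lemma iteratedDeriv_eq_zero_of_right {f : ℝ → ℂ} (hf : ContDiffAt ℝ ∞ f 0)
    (h : ∀ᶠ t in 𝓝[>] 0, f t = 0) (n : ℕ) : iteratedDeriv n f 0 = 0 := by
  have hc : ContinuousAt (iteratedDeriv n f) 0 := (hasDerivAt_iteratedDeriv hf n).continuousAt
  have h1 : Tendsto (iteratedDeriv n f) (𝓝[>] 0) (𝓝 (iteratedDeriv n f 0)) :=
    hc.tendsto.mono_left nhdsWithin_le_nhds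
  refine tendsto_nhds_unique h1 ?_
  refine Tendsto.congr' ?_ tendsto_const_nhds
  obtain ⟨ε, hε, hsub⟩ := mem_nhdsGT_iff_exists_Ioo_subset.1 h
  filter_upwards [Ioo_mem_nhdsGT hε] with t ht
  have : f =ᶠ[𝓝 t] fun _ => (0 : ℂ) := by
    filter_upwards [isOpen_Ioo.mem_nhds ht] with y hy using hsub hy
  rw [this.iteratedDeriv_eq n]
  simp

/-- The necessary condition of the Denjoy–Carleman theorem. -/
lemma not_summable_of_taylor_injective {m : ℕ → ℝ} (hm : IsWeight m) {d : ℕ}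
    (hinj : ∀ f g : (Fin (d + 1) → ℝ) → ℂ,
      InRing m f → InRing m g → taylor f = taylor g → f =ᶠ[𝓝 0] g) :
    ¬ Summable fun j : ℕ => m j / ((j + 1) * m (j + 1)) := by
  intro hs
  obtain ⟨f, hf, hz, hne⟩ := exists_flat hm hs
  have hflat := iteratedDeriv_eq_zero_of_right (hf.contDiffAt 0 (mem_univ _))
    (by filter_upwards [self_mem_nhdsWithin] with t ht using hz t ht)
  have hR : InRing m (fun x : Fin (d + 1) → ℝ => f (x 0)) :=
    inRing_comp_proj isOpen_univ (mem_univ _) hf 0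
  have hR0 : InRing m (fun _ : Fin (d + 1) → ℝ => (0 : ℂ)) :=
    inRing_comp_proj (p := fun _ => 0) isOpen_univ (mem_univ _) (DCOn.const hm 0) 0
  have hon : ContDiffOn ℝ ∞ f univ := fun x hx => (hf.contDiffAt x hx).contDiffWithinAt
  have hT : ∀ α, taylor (fun x : Fin (d + 1) → ℝ => f (x 0)) α = 0 := fun α => by
    have := iteratedFDeriv_comp_clm_apply isOpen_univ hon
      (ContinuousLinearMap.proj 0 : (Fin (d + 1) → ℝ) →L[ℝ] ℝ) (x := 0) (mem_univ _) (∑ i, α i)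
      (fun j => Pi.single (finSigmaFinEquiv.symm j).1 (1 : ℝ))
    rw [taylor, partialDeriv]
    change (iteratedFDeriv ℝ _ (fun y : Fin (d + 1) → ℝ =>
      f ((ContinuousLinearMap.proj 0 : (Fin (d + 1) → ℝ) →L[ℝ] ℝ) y)) 0 _) / _ = 0
    rw [this, iteratedFDeriv_apply_eq_iteratedDeriv_mul_prod, map_zero, hflat, smul_zero, zero_div]
  have hT0 : ∀ α, taylor (fun _ : Fin (d + 1) → ℝ => (0 : ℂ)) α = 0 := fun α => by
    rw [taylor, partialDeriv, iteratedFDeriv_fun_zero]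
    simp
  have := hinj _ _ hR hR0 (funext fun α => by rw [hT, hT0])
  apply hne
  have hc : Tendsto (fun t : ℝ => (Pi.single 0 t : Fin (d + 1) → ℝ)) (𝓝 0) (𝓝 0) := by
    have := (ContinuousLinearMap.single ℝ (fun _ : Fin (d + 1) => ℝ) 0).continuous.tendsto 0
    simpa using this
  filter_upwards [hc.eventually this] with t ht
  simpa using ht

/-! ### Symmetry of iterated derivatives, and analyticity from geometric bounds -/

section ListDeriv

variable {E : Type*} [NormedAddCommGroup E] [NormedSpace ℝ E]

/-- Iterated directional derivatives; the head of the list is the last direction applied. -/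
noncomputable def listDeriv : List E → (E → ℂ) → E → ℂ
  | [], f => f
  | v :: l, f => fun x => fderiv ℝ (listDeriv l f) x v

variable {f : E → ℂ} {U : Set E}

lemma contDiffOn_listDeriv (hU : IsOpen U) (hf : ContDiffOn ℝ ∞ f U) (l : List E) :
    ContDiffOn ℝ ∞ (listDeriv l f) U := by
  induction l with
  | nil => exact hf
  | cons v l ih => exact (ih.fderiv_of_isOpen hU (by simp)).clm_apply contDiffOn_const

lemma fderiv_eq_of_eqOn {g h : E → ℂ} (hU : IsOpen U) (heq : EqOn g h U) {x : E} (hx : x ∈ U) :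
    fderiv ℝ g x = fderiv ℝ h x := by
  apply Filter.EventuallyEq.fderiv_eq
  filter_upwards [hU.mem_nhds hx] with y hy using heq hy

/-- Permutations are generated by adjacent swaps, and a swap is the symmetry of the second
derivative. -/
lemma listDeriv_perm (hU : IsOpen U) (hf : ContDiffOn ℝ ∞ f U) {l l' : List E} (h : l.Perm l') :
    EqOn (listDeriv l f) (listDeriv l' f) U := by
  induction h with
  | nil => exact fun x _ => rfl
  | cons v _ ih => exact fun x hx => by simp only [listDeriv, fderiv_eq_of_eqOn hU ih hx]
  | swap v w l =>
    intro x hx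
    have hg := (contDiffOn_listDeriv hU hf l).contDiffAt (hU.mem_nhds hx)
    have hd : DifferentiableAt ℝ (fderiv ℝ (listDeriv l f)) x :=
      (hg.fderiv_right (m := ∞) (by simp)).differentiableAt (by simp)
    have happ : ∀ u u' : E, fderiv ℝ (fun y => fderiv ℝ (listDeriv l f) y u) x u' =
        fderiv ℝ (fderiv ℝ (listDeriv l f)) x u' u := fun u u' => by
      rw [fderiv_clm_apply hd (differentiableAt_const _)]
      simp
    have hs := hg.isSymmSndFDerivAt (by simpa using WithTop.coe_le_coe.2 (le_top : (2 : ℕ∞) ≤ ⊤))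
    simp only [listDeriv, happ]
    exact hs.eq _ _
  | trans _ _ ih₁ ih₂ => exact ih₁.trans ih₂

lemma iteratedFDeriv_eq_listDeriv (hU : IsOpen U) (hf : ContDiffOn ℝ ∞ f U) {k : ℕ}
    (v : Fin k → E) : EqOn (fun x => iteratedFDeriv ℝ k f x v) (listDeriv (List.ofFn v) f) U := by
  induction k with
  | zero => exact fun x _ => by simp [listDeriv]
  | succ k ih =>
    intro x hx
    have hd : DifferentiableAt ℝ (iteratedFDeriv ℝ k f) x :=
      (hf.contDiffAt (hU.mem_nhds hx)).differentiableAt_iteratedFDeriv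
        (by exact_mod_cast WithTop.coe_lt_top _)
    have h1 := fderiv_eq_of_eqOn hU (ih (Fin.tail v)) hx
    simp only [List.ofFn_succ, listDeriv]
    rw [iteratedFDeriv_succ_apply_left]
    change _ = fderiv ℝ (listDeriv (List.ofFn (Fin.tail v)) f) x (v 0)
    rw [← h1]
    have := (ContinuousMultilinearMap.apply ℝ (fun _ : Fin k => E) ℂ (Fin.tail v)).hasFDerivAt.comp x
      hd.hasFDerivAt
    rw [HasFDerivAt.fderiv (f := fun x => iteratedFDeriv ℝ k f x (Fin.tail v)) this]
    rfl

end ListDeriv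

lemma ofFn_comp_equiv_perm {X : Type*} {k l : ℕ} (σ : Fin k ≃ Fin l) (q : Fin l → X) :
    (List.ofFn (q ∘ σ)).Perm (List.ofFn q) := by
  obtain rfl : k = l := by simpa using Fintype.card_congr σ
  exact Equiv.Perm.ofFn_comp_perm σ q

section

variable {m : ℕ → ℝ} {n : ℕ} {f : (Fin n → ℝ) → ℂ} {U : Set (Fin n → ℝ)}

/-- `α` counts how often each direction occurs in `r`; sorting the directions by fibres of `r` is a
permutation of the list. -/
lemma exists_partialDeriv_eq (hU : IsOpen U) (hf : ContDiffOn ℝ ∞ f U) {k : ℕ} (r : Fin k → Fin n) :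
    ∃ α : Fin n → ℕ, ∑ i, α i = k ∧ ∀ x ∈ U,
      iteratedFDeriv ℝ k f x (fun j => Pi.single (r j) 1) = partialDeriv α f x := by
  classical
  set α : Fin n → ℕ := fun i => Fintype.card {j // r j = i} with hα
  let σ : Fin k ≃ Fin (∑ i, α i) := (Equiv.sigmaFiberEquiv r).symm.trans
    ((Equiv.sigmaCongrRight fun i => Fintype.equivFin {j // r j = i}).trans finSigmaFinEquiv)
  have hσ : ∀ j, (finSigmaFinEquiv.symm (σ j)).1 = r j := fun j => by
    simp [σ, Equiv.sigmaFiberEquiv]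
  refine ⟨α, ?_, fun x hx => ?_⟩
  · simpa using (Fintype.card_congr σ).symm
  · have h1 := ofFn_comp_equiv_perm σ
      (fun j => (Pi.single (finSigmaFinEquiv.symm j).1 (1 : ℝ) : Fin n → ℝ))
    have h2 : ((fun j => (Pi.single (finSigmaFinEquiv.symm j).1 (1 : ℝ) : Fin n → ℝ)) ∘ σ)
        = fun j => Pi.single (r j) 1 := by
      funext j; simp only [Function.comp, hσ]
    rw [h2] at h1
    have h3 := listDeriv_perm hU hf h1 hx
    rw [← iteratedFDeriv_eq_listDeriv hU hf _ hx, ← iteratedFDeriv_eq_listDeriv hU hf _ hx] at h3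
    exact h3

lemma norm_iteratedFDeriv_le_of_partialDeriv (hU : IsOpen U) (hf : ContDiffOn ℝ ∞ f U) {x : Fin n → ℝ}
    (hx : x ∈ U) (k : ℕ) {C : ℝ} (hC0 : 0 ≤ C)
    (hC : ∀ α : Fin n → ℕ, ∑ i, α i = k → ‖partialDeriv α f x‖ ≤ C) :
    ‖iteratedFDeriv ℝ k f x‖ ≤ (n : ℝ) ^ k * C := by
  refine ContinuousMultilinearMap.opNorm_le_bound (by positivity) fun v => ?_
  have hv : v = fun j => ∑ i, v j i • (Pi.single i (1 : ℝ) : Fin n → ℝ) := by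
    funext j
    exact pi_eq_sum_univ' (v j)
  have h1 : iteratedFDeriv ℝ k f x v = ∑ r : Fin k → Fin n,
      (∏ j, v j (r j)) • iteratedFDeriv ℝ k f x (fun j => Pi.single (r j) 1) := by
    conv_lhs => rw [hv]
    rw [ContinuousMultilinearMap.map_sum]
    exact Finset.sum_congr rfl fun r _ => ContinuousMultilinearMap.map_smul_univ _ _ _
  rw [h1]
  calc _ ≤ ∑ r : Fin k → Fin n, C * ∏ j, ‖v j‖ := by
        refine (norm_sum_le _ _).trans (Finset.sum_le_sum fun r _ => ?_)
        obtain ⟨α, hα, h⟩ := exists_partialDeriv_eq hU hf r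
        rw [h x hx, norm_smul, norm_prod, mul_comm]
        gcongr
        · exact hC α hα
        · exact norm_le_pi_norm _ _
    _ = _ := by
        rw [Finset.sum_const, Finset.card_univ, Fintype.card_fun, Fintype.card_fin, Fintype.card_fin,
          nsmul_eq_mul]
        push_cast; ring

/-- Geometric bounds on the Taylor coefficients near a point imply analyticity. -/
lemma analyticAt_of_iteratedFDeriv_le {E : Type*} [NormedAddCommGroup E] [NormedSpace ℝ E]
    {f : E → ℂ} {U : Set E} (hU : IsOpen U) (h0 : 0 ∈ U) (hf : ContDiffOn ℝ ∞ f U) {A R : ℝ}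
    (hR : 0 < R) (H : ∀ x ∈ U, ∀ k : ℕ, ‖iteratedFDeriv ℝ k f x‖ ≤ (k ! : ℝ) * A * R ^ k) :
    AnalyticAt ℝ f 0 := by
  obtain ⟨ε, hε, hball⟩ := Metric.isOpen_iff.1 hU 0 h0
  -- On this ball `‖y‖ * R ≤ 1 / 2`, so the series converges geometrically, and the integral
  -- remainder of order `N + 1` is at most `A * (N + 1) / 2 ^ (N + 1)`.
  set ρ : ℝ := min ε (2 * R)⁻¹ with hρ
  have hρ0 : 0 < ρ := lt_min hε (by positivity)
  have hρR : ρ * R ≤ 1 / 2 := by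
    calc ρ * R ≤ (2 * R)⁻¹ * R := by gcongr; exact min_le_right _ _
      _ = 1 / 2 := by field_simp
  have hA : 0 ≤ A := by simpa using (norm_nonneg _).trans (H 0 h0 0)
  set p : FormalMultilinearSeries ℝ E ℂ := fun k => (k ! : ℝ)⁻¹ • iteratedFDeriv ℝ k f 0 with hp
  have hpk : ∀ k, ‖p k‖ ≤ A * R ^ k := fun k => by
    have hk : (0 : ℝ) < (k ! : ℝ) := by positivity
    rw [hp, norm_smul, norm_inv, Real.norm_natCast, inv_mul_le_iff₀ hk]
    exact (H 0 h0 k).trans_eq (by ring)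
  refine ⟨p, ENNReal.ofReal ρ, ?_, by simpa using hρ0, ?_⟩
  · refine p.le_radius_of_bound A (r := ρ.toNNReal) fun k => ?_
    rw [Real.coe_toNNReal _ hρ0.le]
    calc ‖p k‖ * ρ ^ k ≤ A * R ^ k * ρ ^ k := by gcongr; exact hpk k
      _ = A * (ρ * R) ^ k := by rw [mul_pow]; ring
      _ ≤ A * 1 := by
          gcongr
          exact pow_le_one₀ (by positivity) (by linarith)
      _ = A := mul_one A
  · intro y hy
    have hy' : ‖y‖ < ρ := by
      simpa [Metric.eball_ofReal] using hy
    have hyR : ‖y‖ * R ≤ 1 / 2 := by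
      calc ‖y‖ * R ≤ ρ * R := by gcongr
        _ ≤ 1 / 2 := hρR
    have hterm : ∀ k, ‖p k fun _ => y‖ ≤ A * (1 / 2) ^ k := fun k => by
      calc ‖p k fun _ => y‖ ≤ ‖p k‖ * ∏ _j : Fin k, ‖y‖ := (p k).le_opNorm _
        _ ≤ (A * R ^ k) * ‖y‖ ^ k := by
            rw [Finset.prod_const, Finset.card_univ, Fintype.card_fin]; gcongr; exact hpk k
        _ = A * (‖y‖ * R) ^ k := by rw [mul_pow]; ring
        _ ≤ A * (1 / 2) ^ k := by gcongr
    have hsum : Summable fun k => p k fun _ => y :=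
      Summable.of_norm_bounded ((summable_geometric_of_lt_one (by norm_num) (by norm_num)).mul_left A)
        hterm
    have hseg : ∀ t ∈ Icc (0 : ℝ) 1, (0 : E) + t • y ∈ U := fun t ht => hball <| by
      rw [zero_add, mem_ball_zero_iff, norm_smul, Real.norm_eq_abs, abs_of_nonneg ht.1]
      calc t * ‖y‖ ≤ 1 * ‖y‖ := by gcongr; exact ht.2
        _ < ε := by rw [one_mul]; exact hy'.trans_le (min_le_left _ _)
    have htay : ∀ N : ℕ, ‖f (0 + y) - ∑ k ∈ Finset.range (N + 1), p k fun _ => y‖ ≤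
        A * (((N : ℝ) + 1) * (1 / 2) ^ (N + 1)) := by
      intro N
      have := map_add_eq_sum_add_integral_iteratedFDeriv (f := f) (x := 0) (y := y) (n := N)
        (fun t ht => (hf.contDiffAt (hU.mem_nhds (hseg t ht))).of_le (by exact_mod_cast le_top))
      have hps : ∑ k ∈ Finset.range (N + 1), (p k fun _ => y) = ∑ k ∈ Finset.range (N + 1),
          (k ! : ℝ)⁻¹ • (iteratedFDeriv ℝ k f 0 (fun _ ↦ y)) := rfl
      rw [this, hps, add_sub_cancel_left, norm_smul, norm_inv, Real.norm_natCast,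
        inv_mul_le_iff₀ (by positivity)]
      refine (intervalIntegral.norm_integral_le_of_norm_le_const
        (C := ((N + 1)! : ℝ) * A * (1 / 2) ^ (N + 1)) fun t ht => ?_).trans_eq ?_
      · rw [uIoc_of_le zero_le_one] at ht
        have ht1 : ‖(1 - t) ^ N‖ ≤ 1 := by
          rw [norm_pow, Real.norm_eq_abs, abs_of_nonneg (by linarith [ht.2])]
          exact pow_le_one₀ (by linarith [ht.2]) (by linarith [ht.1])
        have ht2 : ‖iteratedFDeriv ℝ (N + 1) f (0 + t • y) (fun _ => y)‖ ≤
            ((N + 1)! : ℝ) * A * (1 / 2) ^ (N + 1) := by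
          calc _ ≤ ‖iteratedFDeriv ℝ (N + 1) f (0 + t • y)‖ * ∏ _j : Fin (N + 1), ‖y‖ :=
                ContinuousMultilinearMap.le_opNorm _ _
            _ ≤ ((N + 1)! : ℝ) * A * R ^ (N + 1) * ‖y‖ ^ (N + 1) := by
                rw [Finset.prod_const, Finset.card_univ, Fintype.card_fin]
                gcongr
                exact H _ (hseg t ⟨ht.1.le, ht.2⟩) _
            _ = ((N + 1)! : ℝ) * A * (‖y‖ * R) ^ (N + 1) := by rw [mul_pow]; ring
            _ ≤ _ := by gcongr
        rw [norm_smul]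
        calc _ ≤ 1 * (((N + 1)! : ℝ) * A * (1 / 2) ^ (N + 1)) := by gcongr
          _ = _ := one_mul _
      · rw [Nat.factorial_succ]; push_cast; simp; ring
    have hlim : Tendsto (fun N : ℕ => ∑ k ∈ Finset.range (N + 1), p k fun _ => y) atTop
        (𝓝 (f (0 + y))) := by
      rw [tendsto_iff_norm_sub_tendsto_zero]
      have hz : Tendsto (fun N : ℕ => A * (((N : ℝ) + 1) * (1 / 2) ^ (N + 1))) atTop (𝓝 (A * 0)) := by
        refine Tendsto.const_mul A ?_
        have := (tendsto_self_mul_const_pow_of_lt_one (r := (1 / 2 : ℝ)) (by norm_num)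
          (by norm_num)).comp (tendsto_add_atTop_nat 1)
        refine this.congr fun N => ?_
        simp
      rw [mul_zero] at hz
      refine squeeze_zero (fun _ => norm_nonneg _) (fun N => ?_) hz
      rw [norm_sub_rev]; exact htay N
    have h2 := hsum.hasSum
    rwa [tendsto_nhds_unique ((h2.tendsto_sum_nat).comp (tendsto_add_atTop_nat 1)) hlim] at h2

/-- A geometrically bounded weight defines only analytic germs, which proper containment of the
analytic ring excludes. Hence a quasi-analytic weight outgrows every geometric sequence. -/
lemma InRing.analyticAt (hf : InRing m f) {C : ℝ} (hm : ∀ j, 0 ≤ m j) (hC : ∀ j, m j ≤ C ^ j) :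
    AnalyticAt ℝ f 0 := by
  obtain ⟨U, hU, h0, hfc, A, B, hA, hB, H⟩ := hf
  set R : ℝ := ((n : ℝ) + 1) * B * (|C| + 1) with hR
  refine analyticAt_of_iteratedFDeriv_le hU h0 hfc (A := A) (R := R) (by positivity) fun x hx k => ?_
  have hmk : m k ≤ (|C| + 1) ^ k := (hC k).trans <| (le_abs_self _).trans <| by
    rw [abs_pow]; gcongr; linarith
  have h1 := norm_iteratedFDeriv_le_of_partialDeriv hU hfc hx k
    (C := (k ! : ℝ) * A * B ^ k * m k) (by have := hm k; positivity)
    (fun α hα => by have := H x hx α; rwa [hα] at this)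
  have hmk0 := hm k
  calc _ ≤ _ := h1
    _ ≤ ((n : ℝ) + 1) ^ k * ((k ! : ℝ) * A * B ^ k * (|C| + 1) ^ k) := by
        gcongr; linarith
    _ = _ := by rw [hR, mul_pow, mul_pow]; ring

end

/-! ### Analytic germs belong to every class -/

/-- Cauchy estimates for real analytic functions of one variable. -/
lemma dcOn_of_analyticAt {m : ℕ → ℝ} (hm : IsWeight m) {h : ℝ → ℂ} (hh : AnalyticAt ℝ h 0) :
    ∃ δ : ℝ, 0 < δ ∧ DCOn m (Ioo (-δ) δ) h := by
  obtain ⟨p, r, hp⟩ := hh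
  obtain ⟨ρ, hρ0, hρr⟩ := ENNReal.lt_iff_exists_nnreal_btwn.1 hp.r_pos
  have hρ0' : 0 < ρ := by exact_mod_cast hρ0
  have hhalf : ((ρ / 2 : NNReal) + (ρ / 2 : NNReal) : ENNReal) < p.radius := by
    rw [← ENNReal.coe_add, add_halves]; exact hρr.trans_le hp.r_le
  have hS := NNReal.summable_sigma.1 (p.changeOriginSeries_summable_aux₁ hhalf)
  -- One convergent double sum majorizes the recentred power series at all points of the half-radius
  -- interval at once.
  set T := ∑' k, ∑' s : Σ l : ℕ, { s : Finset (Fin (k + l)) // s.card = l },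
      ‖p (k + s.1)‖₊ * (ρ / 2) ^ s.1 * (ρ / 2) ^ k with hT
  have hlt : ∀ x ∈ Ioo (-((ρ / 2 : NNReal) : ℝ)) (ρ / 2 : NNReal), ‖x‖₊ ≤ ρ / 2 := fun x hx => by
    rw [← NNReal.coe_le_coe, coe_nnnorm, Real.norm_eq_abs]
    exact (abs_lt.2 hx).le
  have hlt' : ∀ x ∈ Ioo (-((ρ / 2 : NNReal) : ℝ)) (ρ / 2 : NNReal), (‖x‖₊ : ENNReal) < ρ :=
    fun x hx => by
      rw [ENNReal.coe_lt_coe]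
      exact (hlt x hx).trans_lt (NNReal.half_lt_self hρ0'.ne')
  have hps : ∀ x ∈ Ioo (-((ρ / 2 : NNReal) : ℝ)) (ρ / 2 : NNReal),
      HasFPowerSeriesOnBall h (p.changeOrigin x) x (r - ‖x‖₊) := fun x hx => by
    simpa using hp.changeOrigin ((hlt' x hx).trans hρr)
  refine ⟨(ρ / 2 : NNReal), by exact_mod_cast half_pos hρ0', DCOn.of_bounds hm (fun x hx => ?_)
    (A := T) (B := ((ρ / 2 : NNReal) : ℝ)⁻¹) (fun k x hx => ?_) (by positivity)⟩
  · exact (hps x hx).analyticAt.contDiffAt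
  · have h1 := (hps x hx).factorial_smul 1 k
    have h2 : iteratedDeriv k h x = k ! • p.changeOrigin x k fun _ => 1 := by
      rw [h1, iteratedDeriv_eq_iteratedFDeriv]
    have h3 : ‖p.changeOrigin x k‖₊ * (ρ / 2) ^ k ≤ T := by
      calc _ ≤ (∑' s : Σ l : ℕ, { s : Finset (Fin (k + l)) // s.card = l },
            ‖p (k + s.1)‖₊ * ‖x‖₊ ^ s.1) * (ρ / 2) ^ k := by
            gcongr
            exact p.nnnorm_changeOrigin_le k ((hlt' x hx).trans (hρr.trans_le hp.r_le))
        _ = ∑' s : Σ l : ℕ, { s : Finset (Fin (k + l)) // s.card = l },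
            ‖p (k + s.1)‖₊ * ‖x‖₊ ^ s.1 * (ρ / 2) ^ k := by rw [NNReal.tsum_mul_right]
        _ ≤ ∑' s : Σ l : ℕ, { s : Finset (Fin (k + l)) // s.card = l },
            ‖p (k + s.1)‖₊ * (ρ / 2) ^ s.1 * (ρ / 2) ^ k := by
            have hs' := hS.1 k
            refine (NNReal.summable_of_le (fun s => ?_) hs').tsum_le_tsum (fun s => ?_) hs' <;>
            · gcongr
              exact hlt x hx
        _ ≤ T := hS.2.le_tsum' k
    have h4 : ‖p.changeOrigin x k fun _ => 1‖ ≤ ‖p.changeOrigin x k‖ := by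
      refine ((p.changeOrigin x k).le_opNorm fun _ => 1).trans_eq ?_
      simp
    have h5 : ‖p.changeOrigin x k‖ ≤ T * ((ρ / 2 : NNReal) : ℝ)⁻¹ ^ k := by
      have h3' : ‖p.changeOrigin x k‖ * ((ρ / 2 : NNReal) : ℝ) ^ k ≤ T := by exact_mod_cast h3
      have hpos : (0 : ℝ) < ((ρ / 2 : NNReal) : ℝ) ^ k := by
        have : (0 : ℝ) < ((ρ / 2 : NNReal) : ℝ) := by exact_mod_cast half_pos hρ0'
        positivity
      rw [inv_pow, ← div_eq_mul_inv, le_div_iff₀ hpos]; exact h3'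
    rw [h2, nsmul_eq_mul, norm_mul, Complex.norm_natCast]
    have hm1 := hm.one_le k
    calc _ ≤ (k ! : ℝ) * (T * ((ρ / 2 : NNReal) : ℝ)⁻¹ ^ k) := by gcongr; exact h4.trans h5
      _ ≤ (k ! : ℝ) * (T * ((ρ / 2 : NNReal) : ℝ)⁻¹ ^ k) * m k :=
          le_mul_of_one_le_right (by positivity) hm1
      _ = _ := by ring

lemma inRing_of_analyticAt_fin_one {m : ℕ → ℝ} (hm : IsWeight m) {f : (Fin 1 → ℝ) → ℂ}
    (hf : AnalyticAt ℝ f 0) : InRing m f := by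
  have h3 : ∀ x : Fin 1 → ℝ, (Pi.single 0 (x 0) : Fin 1 → ℝ) = x := fun x => by
    funext i; rw [Subsingleton.elim i 0]; simp
  have hl : AnalyticAt ℝ (fun t : ℝ => f (Pi.single 0 t)) 0 :=
    AnalyticAt.comp_of_eq hf
      ((ContinuousLinearMap.single ℝ (fun _ : Fin 1 => ℝ) 0).analyticAt 0) (by simp)
  obtain ⟨δ, hδ, hD⟩ := dcOn_of_analyticAt hm hl
  have := inRing_comp_proj isOpen_Ioo (by constructor <;> linarith) hD (0 : Fin 1)
  simpa only [h3] using this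

/-! ### Enlarging a weight without losing quasi-analyticity -/

/-- The Abel–Dini theorem: dividing the terms of a divergent series by its partial sums leaves it
divergent. -/
lemma not_summable_div_partialSum {b : ℕ → ℝ} (hb : ∀ j, 0 ≤ b j) (hdiv : ¬ Summable b) :
    ¬ Summable fun j => b j / (1 + ∑ i ∈ Finset.range (j + 1), b i) := by
  intro hs
  set S : ℕ → ℝ := fun j => ∑ i ∈ Finset.range j, b i with hS
  have hS0 : ∀ j, 0 ≤ S j := fun j => Finset.sum_nonneg fun i _ => hb i
  have hSm : Monotone S := monotone_nat_of_le_succ fun j => by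
    simp only [hS, Finset.sum_range_succ]; linarith [hb j]
  rw [not_summable_iff_tendsto_nat_atTop_of_nonneg hb] at hdiv
  obtain ⟨N, hN⟩ := ((tendsto_sum_nat_add fun j => b j / (1 + S (j + 1))).eventually_lt_const
    (show (0 : ℝ) < 1 / 2 by norm_num)).exists
  -- A tail of the quotient series is below `1/2`, but the block from `N` to `P` contributes at
  -- least `(S P - S N) / (1 + S P)`, and `S P ≥ 1 + 2 * S N` makes this at least `1/2`.
  obtain ⟨P, hP, hNP⟩ := ((hdiv.eventually_ge_atTop (1 + 2 * S N)).and
    (eventually_ge_atTop N)).exists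
  obtain ⟨q, rfl⟩ := Nat.exists_eq_add_of_le hNP
  have hsN : Summable fun j => b (j + N) / (1 + S (j + N + 1)) :=
    (summable_nat_add_iff (f := fun j => b j / (1 + S (j + 1))) N).2 hs
  have h1 : ∑ j ∈ Finset.range q, b (j + N) / (1 + S (j + N + 1)) < 1 / 2 :=
    (hsN.sum_le_tsum _ fun j _ => div_nonneg (hb _) (by linarith [hS0 (j + N + 1)])).trans_lt hN
  have h2 : (S (N + q) - S N) / (1 + S (N + q)) ≤
      ∑ j ∈ Finset.range q, b (j + N) / (1 + S (j + N + 1)) := by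
    have h3 : S (N + q) - S N = ∑ j ∈ Finset.range q, b (j + N) := by
      simp only [hS]
      rw [Finset.sum_range_add, add_sub_cancel_left]
      exact Finset.sum_congr rfl fun j _ => by rw [add_comm]
    rw [h3, Finset.sum_div]
    refine Finset.sum_le_sum fun j hj => ?_
    have hjq := Finset.mem_range.1 hj
    have := hS0 (j + N + 1)
    have := hb (j + N)
    have hle : S (j + N + 1) ≤ S (N + q) := hSm (by omega)
    gcongr
  have h4 : 1 / 2 ≤ (S (N + q) - S N) / (1 + S (N + q)) := by
    have hP' : 1 + 2 * S N ≤ S (N + q) := hP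
    rw [le_div_iff₀ (by linarith [hS0 (N + q)])]
    linarith
  linarith

/-- Every weight satisfying the Denjoy–Carleman condition is dominated by a much larger one that
satisfies it too. -/
lemma exists_larger_weight {m : ℕ → ℝ} (hm : IsWeight m)
    (hdiv : ¬ Summable fun j : ℕ => m j / ((j + 1) * m (j + 1))) :
    ∃ k : ℕ → ℝ, IsWeight k ∧ (∀ j, m j ≤ k j) ∧
      (¬ Summable fun j : ℕ => k j / ((j + 1) * k (j + 1))) ∧
      ∀ R : ℝ, 1 ≤ R → ∀ᶠ j in atTop, R ^ j * m j ≤ k j := by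
  set b : ℕ → ℝ := fun j => m j / ((j + 1) * m (j + 1)) with hb
  have hb0 : ∀ j, 0 < b j := fun j => by
    have := hm.pos j; have := hm.pos (j + 1); positivity
  have hb1 : ∀ j, b j ≤ 1 := fun j => by
    have h1 := hm.pos (j + 1)
    rw [hb, div_le_one (by positivity)]
    have h2 : m j ≤ m (j + 1) := hm.mono (Nat.le_succ j)
    nlinarith [(Nat.cast_nonneg j : (0 : ℝ) ≤ j)]
  -- The ratios of the new weight are those of `m` times `θ`. Monotonicity of `θ` keeps
  -- log-convexity, `θ j ≤ j + 2` keeps the root condition, divergence of `θ` gives the growth, and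
  -- Abel–Dini preserves the divergence of the series.
  set θ : ℕ → ℝ := fun j => 1 + ∑ i ∈ Finset.range (j + 1), b i with hθ
  have hθ1 : ∀ j, 1 ≤ θ j := fun j => by
    have : 0 ≤ ∑ i ∈ Finset.range (j + 1), b i := Finset.sum_nonneg fun i _ => (hb0 i).le
    simp only [hθ]; linarith
  have hθ0 : ∀ j, 0 < θ j := fun j => by linarith [hθ1 j]
  have hθm : Monotone θ := monotone_nat_of_le_succ fun j => by
    simp only [hθ, Finset.sum_range_succ _ (j + 1)]; linarith [hb0 (j + 1)]
  have hθle : ∀ j, θ j ≤ j + 2 := fun j => by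
    have := Finset.sum_le_card_nsmul (Finset.range (j + 1)) b 1 fun i _ => hb1 i
    simp at this
    simp only [hθ]; linarith
  have hθtop : Tendsto θ atTop atTop := by
    have h := hdiv
    rw [not_summable_iff_tendsto_nat_atTop_of_nonneg (fun j => (hb0 j).le)] at h
    exact tendsto_atTop_add_const_left _ 1 (h.comp (tendsto_add_atTop_nat 1))
  set Q : ℕ → ℝ := fun j => ∏ i ∈ Finset.range j, θ i with hQ
  have hQ1 : ∀ j, 1 ≤ Q j := fun j => by
    induction j with
    | zero => simp [hQ]
    | succ j ih =>
      have : Q (j + 1) = Q j * θ j := Finset.prod_range_succ _ _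
      rw [this]; nlinarith [hθ1 j]
  have hQ0 : ∀ j, 0 < Q j := fun j => by linarith [hQ1 j]
  have hQs : ∀ j, Q (j + 1) = Q j * θ j := fun j => Finset.prod_range_succ _ _
  have hratio : ∀ j, m (j + 1) * Q (j + 1) / (m j * Q j) = m (j + 1) / m j * θ j := fun j => by
    have h1 := (hm.pos j).ne'; have h2 := (hQ0 j).ne'
    rw [hQs]; field_simp
  refine ⟨fun j => m j * Q j, ⟨by simp [hQ, hm.zero], fun j => mul_pos (hm.pos j) (hQ0 j), ?_, ?_, ?_⟩,
    fun j => le_mul_of_one_le_right (hm.pos j).le (hQ1 j), ?_, ?_⟩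
  · refine monotone_nat_of_le_succ fun j => ?_
    refine mul_le_mul (hm.mono (Nat.le_succ j)) ?_ (hQ0 j).le (hm.pos _).le
    rw [hQs]; exact le_mul_of_one_le_right (hQ0 j).le (hθ1 j)
  · intro j
    simp only [hratio]
    exact mul_le_mul (hm.logConvex j) (hθm (Nat.le_succ j)) (hθ0 j).le (hm.ratio_pos _).le
  · obtain ⟨C, hC⟩ := hm.root_bdd
    refine ⟨C * 3, fun j hj => ?_⟩
    have hj' : (1 : ℝ) ≤ j := by exact_mod_cast hj
    simp only [hratio]
    rw [Real.mul_rpow (hm.ratio_pos j).le (hθ0 j).le]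
    have h3 : θ j ^ (1 / (j : ℝ)) ≤ 3 := by
      have h4 : θ j ≤ 3 ^ j := by
        have : ((j : ℝ) + 2) ≤ 3 ^ j := by
          have := one_add_mul_le_pow (show (-2 : ℝ) ≤ 2 by norm_num) j
          norm_num at this
          linarith
        exact (hθle j).trans this
      calc θ j ^ (1 / (j : ℝ)) ≤ ((3 : ℝ) ^ j) ^ (1 / (j : ℝ)) :=
            Real.rpow_le_rpow (hθ0 j).le h4 (by positivity)
        _ = 3 := by rw [one_div, Real.pow_rpow_inv_natCast (by norm_num) (by omega)]
    have h5 := hC j hj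
    exact mul_le_mul h5 h3 (Real.rpow_nonneg (hθ0 j).le _)
      ((Real.rpow_nonneg (hm.ratio_pos j).le _).trans h5)
  · have := not_summable_div_partialSum (fun j => (hb0 j).le) hdiv
    intro hs
    apply this
    refine hs.congr fun j => ?_
    have h1 := (hm.pos j).ne'; have h2 := (hQ0 j).ne'; have h3 := (hm.pos (j + 1)).ne'
    have h4 := (hθ0 j).ne'
    have h5 : (j : ℝ) + 1 ≠ 0 := by positivity
    change _ = b j / θ j
    simp only [hQs, hb]
    field_simp
  · intro R hR
    obtain ⟨N, hN⟩ := (hθtop.eventually_ge_atTop (R ^ 2)).exists_forall_of_atTop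
    -- Past `N` each factor is at least `R ^ 2`; once `j ≥ 2 * N` this surplus compensates for the
    -- first `N` factors.
    have hR0 : 0 < R := by linarith
    have key : ∀ q, R ^ (2 * q) ≤ Q (N + q) := fun q => by
      induction q with
      | zero => simpa using hQ1 N
      | succ q ih =>
        rw [← add_assoc, hQs, show 2 * (q + 1) = 2 * q + 2 by ring, pow_add]
        exact mul_le_mul ih (hN _ (by omega)) (by positivity) (hQ0 _).le
    filter_upwards [eventually_ge_atTop (2 * N)] with j hj
    obtain ⟨q, rfl⟩ := Nat.exists_eq_add_of_le (show N ≤ j by omega)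
    rw [mul_comm]
    have : R ^ (N + q) ≤ Q (N + q) := (pow_le_pow_right₀ hR (by omega)).trans (key q)
    exact mul_le_mul_of_nonneg_left this (hm.pos _).le

/-! ### Sums of simple fractions with poles in the upper half-plane -/

/-- The sum of the simple fractions `d l / (x - z l)`. -/
noncomputable def poleSum (d z : ℕ → ℂ) (x : ℝ) : ℂ := ∑' l, d l * ((x : ℂ) - z l)⁻¹

section PoleSum

variable {d z : ℕ → ℂ}

lemma im_le_norm_sub (w : ℂ) (x : ℝ) : w.im ≤ ‖(x : ℂ) - w‖ := by
  have h := Complex.abs_im_le_norm ((x : ℂ) - w)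
  simp only [Complex.sub_im, Complex.ofReal_im, zero_sub, abs_neg] at h
  exact (le_abs_self _).trans h

lemma sub_re_le_norm_sub (w : ℂ) (x : ℝ) : |x - w.re| ≤ ‖(x : ℂ) - w‖ := by
  simpa using Complex.abs_re_le_norm ((x : ℂ) - w)

lemma sub_ne_zero_of_im_pos {w : ℂ} (hw : 0 < w.im) (x : ℝ) : (x : ℂ) - w ≠ 0 :=
  norm_pos_iff.1 (hw.trans_le (im_le_norm_sub w x))

/-- The `i`-th derivative of `d l / (x - z l)`. -/
noncomputable def poleTerm (d z : ℕ → ℂ) (i l : ℕ) (x : ℝ) : ℂ :=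
  d l * ((-1) ^ i * (i ! : ℂ)) * (((x : ℂ) - z l)⁻¹) ^ (i + 1)

lemma norm_poleTerm (i l : ℕ) (x : ℝ) :
    ‖poleTerm d z i l x‖ = (i ! : ℝ) * (‖d l‖ * (‖(x : ℂ) - z l‖⁻¹) ^ (i + 1)) := by
  simp [poleTerm]; ring

lemma hasDerivAt_poleTerm (hz : ∀ l, 0 < (z l).im) (i l : ℕ) (x : ℝ) :
    HasDerivAt (poleTerm d z i l) (poleTerm d z (i + 1) l x) x := by
  have hne := sub_ne_zero_of_im_pos (hz l) x
  have h1 : HasDerivAt (fun x : ℝ => (x : ℂ) - z l) 1 x :=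
    (Complex.ofRealCLM.hasDerivAt (x := x)).sub_const (z l)
  have h2 := ((h1.inv hne).pow (i + 1)).const_mul (d l * ((-1) ^ i * (i ! : ℂ)))
  refine h2.congr_deriv ?_
  simp only [poleTerm, Nat.factorial_succ, Pi.inv_apply, neg_div, one_div, ← inv_pow,
    Nat.add_sub_cancel]
  push_cast
  ring

lemma norm_poleTerm_le (hz : ∀ l, 0 < (z l).im) (i l : ℕ) (x : ℝ) :
    ‖poleTerm d z i l x‖ ≤ (i ! : ℝ) * (‖d l‖ * (((z l).im)⁻¹) ^ (i + 1)) := by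
  rw [norm_poleTerm]
  have := hz l
  gcongr
  exact im_le_norm_sub _ _

lemma summable_poleTerm (hz : ∀ l, 0 < (z l).im)
    (hs : ∀ i : ℕ, Summable fun l => ‖d l‖ * (((z l).im)⁻¹) ^ (i + 1)) (i : ℕ) (x : ℝ) : Summable fun l => poleTerm d z i l x :=
  Summable.of_norm_bounded ((hs i).mul_left (i ! : ℝ)) fun l => norm_poleTerm_le hz i l x

lemma hasDerivAt_tsum_poleTerm (hz : ∀ l, 0 < (z l).im)
    (hs : ∀ i : ℕ, Summable fun l => ‖d l‖ * (((z l).im)⁻¹) ^ (i + 1)) (i : ℕ) (x : ℝ) :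
    HasDerivAt (fun x => ∑' l, poleTerm d z i l x) (∑' l, poleTerm d z (i + 1) l x) x :=
  hasDerivAt_tsum ((hs (i + 1)).mul_left ((i + 1)! : ℝ)) (fun l y => hasDerivAt_poleTerm hz i l y)
    (fun l y => norm_poleTerm_le hz (i + 1) l y) (summable_poleTerm hz hs i 0) x

lemma iteratedDeriv_poleSum (hz : ∀ l, 0 < (z l).im)
    (hs : ∀ i : ℕ, Summable fun l => ‖d l‖ * (((z l).im)⁻¹) ^ (i + 1)) (i : ℕ) :
    iteratedDeriv i (poleSum d z) = fun x => ∑' l, poleTerm d z i l x := by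
  induction i with
  | zero => funext x; simp [poleSum, poleTerm]
  | succ i ih =>
    rw [iteratedDeriv_succ, ih]
    funext x
    exact (hasDerivAt_tsum_poleTerm hz hs i x).deriv

lemma contDiff_poleSum (hz : ∀ l, 0 < (z l).im)
    (hs : ∀ i : ℕ, Summable fun l => ‖d l‖ * (((z l).im)⁻¹) ^ (i + 1)) : ContDiff ℝ ∞ (poleSum d z) :=
  contDiff_of_differentiable_iteratedDeriv fun i _ => by
    rw [iteratedDeriv_poleSum hz hs]
    exact fun x => (hasDerivAt_tsum_poleTerm hz hs i x).differentiableAt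

lemma norm_iteratedDeriv_poleSum_le (hz : ∀ l, 0 < (z l).im)
    (hs : ∀ i : ℕ, Summable fun l => ‖d l‖ * (((z l).im)⁻¹) ^ (i + 1)) {i : ℕ} {x C : ℝ}
    (h : ∀ l, ‖d l‖ * (‖(x : ℂ) - z l‖⁻¹) ^ (i + 1) ≤ C * (1 / 2) ^ l) :
    ‖iteratedDeriv i (poleSum d z) x‖ ≤ (i ! : ℝ) * (2 * C) := by
  rw [iteratedDeriv_poleSum hz hs]
  have hg : HasSum (fun l : ℕ => (i ! : ℝ) * (C * (1 / 2) ^ l)) ((i ! : ℝ) * (C * 2)) :=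
    (hasSum_geometric_two.mul_left C).mul_left _
  refine (tsum_of_norm_bounded hg fun l => ?_).trans_eq (by ring)
  rw [norm_poleTerm]
  exact mul_le_mul_of_nonneg_left (h l) (by positivity)

end PoleSum

/-- With `ν` the ratio at `j`, the sequence `k i / ν ^ i` decreases up to `i = j` and increases from
there, so `j` minimizes it. -/
lemma IsWeight.mul_ratio_pow_le {k : ℕ → ℝ} (hk : IsWeight k) (i j : ℕ) :
    k j * (k (j + 1) / k j) ^ i ≤ k i * (k (j + 1) / k j) ^ j := by
  set ν := k (j + 1) / k j with hν
  have hν0 : 0 < ν := hk.ratio_pos j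
  have up : ∀ p, k j * ν ^ p ≤ k (j + p) := fun p => by
    induction p with
    | zero => simp
    | succ p ih =>
      have h1 : ν ≤ k (j + p + 1) / k (j + p) := hk.ratio_mono (Nat.le_add_right j p)
      rw [← add_assoc, hk.succ_eq (j + p), pow_succ]
      have := (hk.pos (j + p)).le
      calc k j * (ν ^ p * ν) = ν * (k j * ν ^ p) := by ring
        _ ≤ k (j + p + 1) / k (j + p) * k (j + p) := by
            have := hk.pos j
            exact mul_le_mul h1 ih (by positivity) (hν0.le.trans h1)
  have down : ∀ p i, i + p = j → k j ≤ k i * ν ^ p := fun p => by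
    induction p with
    | zero => rintro i rfl; simp
    | succ p ih =>
      intro i hi
      have h1 := ih (i + 1) (by omega)
      have h2 : k (i + 1) / k i ≤ ν := hk.ratio_mono (show i ≤ j by omega)
      rw [div_le_iff₀ (hk.pos i)] at h2
      calc k j ≤ k (i + 1) * ν ^ p := h1
        _ ≤ ν * k i * ν ^ p := by gcongr
        _ = k i * ν ^ (p + 1) := by ring
  rcases le_total j i with h | h
  · obtain ⟨p, rfl⟩ := Nat.exists_eq_add_of_le h
    rw [pow_add]
    have := up p
    calc k j * (ν ^ j * ν ^ p) = (k j * ν ^ p) * ν ^ j := by ring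
      _ ≤ _ := by gcongr
  · obtain ⟨p, rfl⟩ := Nat.exists_eq_add_of_le h
    have := down p i rfl
    rw [pow_add]
    calc k (i + p) * ν ^ i ≤ (k i * ν ^ p) * ν ^ i := by gcongr
      _ = _ := by ring

/-! ### Construction of the half-regular function -/

/-- The choice of the imaginary part and of the size of the residue of one pole. -/
lemma exists_pole_data {m m' k : ℕ → ℝ} (hm' : IsWeight m') (hk : IsWeight k)
    (hgrow : ∀ R : ℝ, 1 ≤ R → ∀ᶠ j in atTop, R ^ j * m' j ≤ k j)
    (hpow : ∀ R : ℝ, 1 ≤ R → ∃ S : ℝ, 0 < S ∧ ∀ i, R ^ i ≤ S * m i) (l : ℕ) :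
    ∃ (j : ℕ) (b r : ℝ), 2 ≤ j ∧ 0 < b ∧ 0 < r ∧
      (∀ i, r * b⁻¹ ^ (i + 1) ≤ (1 / 4) ^ l * k i) ∧
      (∀ i, r * ((l : ℝ) + 1) ^ (i + 2) ≤ (1 / 4) ^ (l + 1) * m i) ∧
      ((l : ℝ) + 1) ^ j * m' j + (((l : ℝ) + 1) * (l + 2)) ^ (j + 1) ≤ r * b⁻¹ ^ (j + 1) := by
  obtain ⟨S, hS, hSm⟩ := hpow ((l : ℝ) + 1) (by linarith [(Nat.cast_nonneg l : (0 : ℝ) ≤ l)])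
  set D : ℝ := ((l : ℝ) + 1) * (l + 2) with hD
  have hl0 : (0 : ℝ) ≤ l := Nat.cast_nonneg l
  have hD1 : (l : ℝ) + 1 ≤ D := by rw [hD]; nlinarith
  have hD1' : 1 ≤ D := by linarith
  -- `R₁` forces `ν ≥ 4 S (l + 1)²` through `R₁ ^ j ≤ k j ≤ ν ^ j`, for smallness seen from the
  -- right half-line; `R₂` lets `k j` beat `m' j` and the other poles. The inverse of `D` bounds
  -- from below the gap between the real parts of the poles.
  set R₁ : ℝ := max 1 (4 * S * ((l : ℝ) + 1) ^ 2) with hR₁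
  set R₂ : ℝ := 4 ^ l * 2 * D ^ 2 with hR₂
  have h4l : (1 : ℝ) ≤ 4 ^ l := one_le_pow₀ (by norm_num)
  have hD2 : 1 ≤ D ^ 2 := one_le_pow₀ hD1'
  have hR₂1 : 1 ≤ R₂ := by
    rw [hR₂]; nlinarith
  obtain ⟨j, ⟨h1, h2⟩, hj⟩ := (((hgrow R₁ (le_max_left _ _)).and (hgrow R₂ hR₂1)).and
    (eventually_ge_atTop 2)).exists
  set ν : ℝ := k (j + 1) / k j with hν
  have hν0 : 0 < ν := hk.ratio_pos j
  have hkj := hk.pos j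
  have hkν : k j ≤ ν ^ j := by simpa [hk.zero] using hk.mul_ratio_pow_le 0 j
  have hνR : R₁ ≤ ν := by
    have h3 : R₁ ^ j ≤ ν ^ j := by
      have : R₁ ^ j ≤ R₁ ^ j * m' j :=
        le_mul_of_one_le_right (pow_nonneg (zero_le_one.trans (le_max_left _ _)) j) (hm'.one_le j)
      linarith
    exact le_of_pow_le_pow_left₀ (by omega) hν0.le h3
  -- With these choices `r * b⁻¹ ^ (i + 1) = (1/4) ^ l * k j * ν ^ i / ν ^ j`, which is at most
  -- `(1/4) ^ l * k i`, with equality at `i = j`.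
  refine ⟨j, ν⁻¹, (1 / 4) ^ l * k j / ν ^ (j + 1), hj, by positivity, by positivity,
    fun i => ?_, fun i => ?_, ?_⟩
  · rw [inv_inv, div_mul_eq_mul_div, div_le_iff₀ (by positivity)]
    have := hk.mul_ratio_pow_le i j
    calc (1 / 4 : ℝ) ^ l * k j * ν ^ (i + 1) = (1 / 4 : ℝ) ^ l * ν * (k j * ν ^ i) := by ring
      _ ≤ (1 / 4 : ℝ) ^ l * ν * (k i * ν ^ j) := by gcongr
      _ = _ := by ring
  · have hSi := hSm i
    have hmi : 0 < m i := by
      have : 0 < S * m i := lt_of_lt_of_le (by positivity) hSi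
      exact pos_of_mul_pos_right this hS.le
    have hr : (1 / 4 : ℝ) ^ l * k j / ν ^ (j + 1) ≤ (1 / 4) ^ l / ν := by
      rw [div_le_div_iff₀ (by positivity) hν0]
      calc (1 / 4 : ℝ) ^ l * k j * ν ≤ (1 / 4 : ℝ) ^ l * ν ^ j * ν := by gcongr
        _ = _ := by ring
    have hX : 4 * S * ((l : ℝ) + 1) ^ 2 ≤ ν := (le_max_right _ _).trans hνR
    calc _ ≤ (1 / 4 : ℝ) ^ l / ν * ((l : ℝ) + 1) ^ (i + 2) := by gcongr
      _ = (1 / 4 : ℝ) ^ l / ν * (((l : ℝ) + 1) ^ i * ((l : ℝ) + 1) ^ 2) := by rw [pow_add]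
      _ ≤ (1 / 4 : ℝ) ^ l / ν * ((S * m i) * ((l : ℝ) + 1) ^ 2) := by gcongr
      _ = (1 / 4 : ℝ) ^ (l + 1) * m i * ((4 * S * ((l : ℝ) + 1) ^ 2) / ν) := by ring
      _ ≤ (1 / 4 : ℝ) ^ (l + 1) * m i * 1 := by
          gcongr
          rw [div_le_one hν0]; exact hX
      _ = _ := mul_one _
  · rw [inv_inv, div_mul_cancel₀ _ (by positivity)]
    have hm1 := hm'.one_le j
    have hDj : D ^ (j + 1) ≤ (D ^ 2) ^ j := by
      rw [← pow_mul]; exact pow_le_pow_right₀ hD1' (by omega)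
    have hlj : ((l : ℝ) + 1) ^ j ≤ (D ^ 2) ^ j := by
      gcongr
      nlinarith
    have hc : (4 : ℝ) ^ l * 2 ≤ (4 ^ l * 2) ^ j := le_self_pow₀ (by linarith) (by omega)
    have hsum : (((l : ℝ) + 1) ^ j * m' j + D ^ (j + 1)) ≤ 2 * (D ^ 2) ^ j * m' j := by
      have hp : 0 ≤ (D ^ 2) ^ j := by positivity
      calc _ ≤ (D ^ 2) ^ j * m' j + (D ^ 2) ^ j * m' j := by
            gcongr
            exact hDj.trans (le_mul_of_one_le_right hp hm1)
        _ = _ := by ring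
    calc _ ≤ 2 * (D ^ 2) ^ j * m' j := hsum
      _ = (1 / 4) ^ l * ((4 ^ l * 2) * (D ^ 2) ^ j * m' j) := by
          rw [one_div, inv_pow]; field_simp
      _ ≤ (1 / 4) ^ l * ((4 ^ l * 2) ^ j * (D ^ 2) ^ j * m' j) := by gcongr
      _ = (1 / 4) ^ l * (R₂ ^ j * m' j) := by rw [← mul_pow]
      _ ≤ (1 / 4) ^ l * k j := by gcongr

lemma iteratedDeriv_add_const_of_two_le {j : ℕ} (hj : 2 ≤ j) (c x : ℝ) :
    iteratedDeriv j (fun x : ℝ => x + c) x = 0 := by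
  obtain ⟨i, rfl⟩ := Nat.exists_eq_add_of_le' hj
  have h1 : deriv (fun x : ℝ => x + c) = fun _ => 1 := by
    funext y; exact ((hasDerivAt_id y).add_const c).deriv
  rw [show i + 2 = (i + 1) + 1 from rfl, iteratedDeriv_succ', h1, iteratedDeriv_const]
  simp

lemma DCOn.id {m : ℕ → ℝ} (hm : IsWeight m) {s : Set ℝ} (hs : ∀ x ∈ s, |x| ≤ 1) :
    DCOn m s (fun x : ℝ => x) := by
  refine of_bounds hm (fun x _ => contDiffAt_id) (A := 1) (B := 1) (fun k x hx => ?_) zero_le_one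
  have hmk := hm.one_le k
  match k with
  | 0 => simpa [hm.zero] using hs x hx
  | 1 => simpa [iteratedDeriv_one] using hmk
  | k + 2 =>
    have := iteratedDeriv_add_const_of_two_le (show 2 ≤ k + 2 by omega) 0 x
    simp only [add_zero] at this
    rw [this, norm_zero]
    positivity

/-- The nearest neighbour of `-1/(l+1)` in this sequence is `-1/(l+2)`. -/
lemma le_abs_inv_sub_inv {l l' : ℕ} (h : l' ≠ l) :
    (((l : ℝ) + 1) * (l + 2))⁻¹ ≤ |-((l : ℝ) + 1)⁻¹ - -((l' : ℝ) + 1)⁻¹| := by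
  have h0 : (0 : ℝ) ≤ l := Nat.cast_nonneg l
  have h0' : (0 : ℝ) ≤ l' := Nat.cast_nonneg l'
  have heq : -((l : ℝ) + 1)⁻¹ - -((l' : ℝ) + 1)⁻¹ = ((l : ℝ) - l') / (((l : ℝ) + 1) * (l' + 1)) := by
    field_simp; ring
  rw [heq, abs_div, abs_of_pos (by positivity : (0 : ℝ) < ((l : ℝ) + 1) * (l' + 1)),
    ← one_div, div_le_div_iff₀ (by positivity) (by positivity)]
  rcases lt_or_gt_of_ne h with hlt | hgt
  · have h1 : (l' : ℝ) + 1 ≤ l := by exact_mod_cast hlt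
    rw [abs_of_pos (by linarith)]
    calc 1 * (((l : ℝ) + 1) * (l' + 1)) ≤ 1 * (((l : ℝ) + 1) * (l + 2)) := by gcongr; linarith
      _ ≤ ((l : ℝ) - l') * (((l : ℝ) + 1) * (l + 2)) := by gcongr; linarith
  · have h1 : (l : ℝ) + 1 ≤ l' := by exact_mod_cast hgt
    rw [abs_of_neg (by linarith)]
    nlinarith [mul_nonneg h0 h0', mul_nonneg h0 (sub_nonneg.2 h1)]

/-- A function with the bounds of `m` on `[0, 1)` and of the larger weight `k` on `(-1, 1)` whose
derivatives at the points `-1 / (l + 1)` exceed all bounds of `m'`. -/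
lemma exists_half_regular_function {m m' k : ℕ → ℝ} (hm : IsWeight m) (hm' : IsWeight m')
    (hk : IsWeight k) (hgrow : ∀ R : ℝ, 1 ≤ R → ∀ᶠ j in atTop, R ^ j * m' j ≤ k j)
    (hpow : ∀ R : ℝ, 1 ≤ R → ∃ S : ℝ, 0 < S ∧ ∀ i, R ^ i ≤ S * m i) :
    ∃ q : ℝ → ℝ, ContDiff ℝ ∞ q ∧ (∀ x, 0 ≤ x → 1 / 2 ≤ q x) ∧ DCOn m (Ico 0 1) q ∧
      DCOn m (Ico 0 1) (fun x => x * q x) ∧ DCOn k (Ioo (-1) 1) (fun x => x * q x) ∧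
      ∀ l : ℕ, ∃ j : ℕ, 1 ≤ j ∧ (j ! : ℝ) * (((l : ℝ) + 1) ^ j * m' j) ≤
        ‖iteratedDeriv j (fun x => x * q x) (-((l : ℝ) + 1)⁻¹)‖ := by
  choose J b r hJ hb hr hK hM hbig using exists_pole_data hm' hk hgrow hpow
  set z : ℕ → ℂ := fun l => ⟨-((l : ℝ) + 1)⁻¹, b l⟩ with hzdef
  -- Below its pole the denominator of the `l`-th fraction is `-I * b l`; the phase is chosen so
  -- that the derivative of order `J l` there is real and positive, and survives taking the real
  -- part.
  set e : ℕ → ℂ := fun l => (r l : ℂ) * ((-1) ^ J l * (-Complex.I) ^ (J l + 1)) with hedef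
  have hl0 : ∀ l : ℕ, (0 : ℝ) ≤ l := fun l => Nat.cast_nonneg l
  have hz : ∀ l, 0 < (z l).im := hb
  have hen : ∀ l, ‖e l‖ = r l := fun l => by
    simp [hedef, abs_of_pos (hr l)]
  have hzn : ∀ l, ‖z l‖⁻¹ ≤ (l : ℝ) + 1 := fun l => by
    have h1 := Complex.abs_re_le_norm (z l)
    simp only [hzdef, abs_neg] at h1
    have h2 : (0 : ℝ) < ((l : ℝ) + 1)⁻¹ := by have := hl0 l; positivity
    rw [abs_of_pos h2] at h1
    exact inv_le_of_inv_le₀ (by have := hl0 l; positivity) h1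
  have hz0 : ∀ l, z l ≠ 0 := fun l h => by
    have := hz l; rw [h] at this; simp at this
  have hezn : ∀ l, ‖e l / z l‖ ≤ r l * ((l : ℝ) + 1) := fun l => by
    rw [norm_div, hen, div_eq_mul_inv]
    have := (hr l).le
    gcongr
    exact hzn l
  have hhalf : ∀ l : ℕ, (1 / 4 : ℝ) ^ l ≤ (1 / 2) ^ l := fun l =>
    pow_le_pow_left₀ (by norm_num) (by norm_num) l
  have hl2 : ∀ l : ℕ, (l : ℝ) + 1 ≤ 2 ^ l := fun l => by exact_mod_cast Nat.lt_two_pow_self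
  have hquarter : ∀ l : ℕ, (1 / 4 : ℝ) ^ l * ((l : ℝ) + 1) ≤ (1 / 2) ^ l := fun l => by
    calc (1 / 4 : ℝ) ^ l * ((l : ℝ) + 1) ≤ (1 / 4 : ℝ) ^ l * 2 ^ l := by gcongr; exact hl2 l
      _ = (1 / 2) ^ l := by rw [← mul_pow]; norm_num
  have hsgeom : ∀ C : ℝ, Summable fun l : ℕ => C * (1 / 2 : ℝ) ^ l := fun C =>
    summable_geometric_two.mul_left C
  have hKe : ∀ i l, ‖e l‖ * ((z l).im)⁻¹ ^ (i + 1) ≤ k i * (1 / 2) ^ l := fun i l => by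
    rw [hen]
    refine (hK l i).trans ?_
    rw [mul_comm]
    exact mul_le_mul_of_nonneg_left (hhalf l) (hk.pos i).le
  have hKez : ∀ i l, ‖e l / z l‖ * ((z l).im)⁻¹ ^ (i + 1) ≤ k i * (1 / 2) ^ l := fun i l => by
    have h1 := hK l i
    have h2 := (hb l).le
    have h3 := (hk.pos i).le
    have h4 := hl0 l
    calc _ ≤ r l * ((l : ℝ) + 1) * (b l)⁻¹ ^ (i + 1) := by
          change _ * (b l)⁻¹ ^ (i + 1) ≤ _
          gcongr; exact hezn l
      _ = r l * (b l)⁻¹ ^ (i + 1) * ((l : ℝ) + 1) := by ring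
      _ ≤ (1 / 4) ^ l * k i * ((l : ℝ) + 1) := by gcongr
      _ = k i * ((1 / 4) ^ l * ((l : ℝ) + 1)) := by ring
      _ ≤ _ := by gcongr; exact hquarter l
  have hse : ∀ i, Summable fun l => ‖e l‖ * (((z l).im)⁻¹) ^ (i + 1) := fun i =>
    Summable.of_nonneg_of_le (fun l => by have := (hz l).le; positivity) (hKe i) (hsgeom _)
  have hsez : ∀ i, Summable fun l => ‖e l / z l‖ * (((z l).im)⁻¹) ^ (i + 1) := fun i =>
    Summable.of_nonneg_of_le (fun l => by have := (hz l).le; positivity) (hKez i) (hsgeom _)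
  have hpos : ∀ l (x : ℝ), 0 ≤ x → ‖(x : ℂ) - z l‖⁻¹ ≤ (l : ℝ) + 1 := fun l x hx => by
    have h1 := sub_re_le_norm_sub (z l) x
    have h4 := hl0 l
    have h2 : (0 : ℝ) < ((l : ℝ) + 1)⁻¹ := by positivity
    have h3 : ((l : ℝ) + 1)⁻¹ ≤ |x - (z l).re| := by
      simp only [hzdef, sub_neg_eq_add]
      rw [abs_of_nonneg (by linarith)]; linarith
    exact inv_le_of_inv_le₀ (by positivity) (h3.trans h1)
  have hMq : ∀ i l, r l * ((l : ℝ) + 1) ^ (i + 2) ≤ m i / 4 * (1 / 2) ^ l := fun i l => by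
    refine (hM l i).trans ?_
    have h1 := (hm.pos i).le
    calc (1 / 4 : ℝ) ^ (l + 1) * m i = m i / 4 * (1 / 4) ^ l := by ring
      _ ≤ _ := mul_le_mul_of_nonneg_left (hhalf l) (by positivity)
  have hMez : ∀ i (x : ℝ), 0 ≤ x →
      ‖iteratedDeriv i (poleSum (fun l => e l / z l) z) x‖ ≤ (i ! : ℝ) * (2 * (m i / 4)) :=
    fun i x hx => norm_iteratedDeriv_poleSum_le hz hsez fun l => by
      refine le_trans ?_ (hMq i l)
      have h1 := hpos l x hx
      have h2 := (hr l).le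
      have h4 := hl0 l
      calc _ ≤ r l * ((l : ℝ) + 1) * ((l : ℝ) + 1) ^ (i + 1) := by gcongr; exact hezn l
        _ = _ := by ring
  have hMe : ∀ i (x : ℝ), 0 ≤ x →
      ‖iteratedDeriv i (poleSum e z) x‖ ≤ (i ! : ℝ) * (2 * (m i / 4)) :=
    fun i x hx => norm_iteratedDeriv_poleSum_le hz hse fun l => by
      refine le_trans ?_ (hMq i l)
      have h1 := hpos l x hx
      have h2 := (hr l).le
      have h4 := hl0 l
      rw [hen]
      calc _ ≤ r l * ((l : ℝ) + 1) ^ (i + 1) := by gcongr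
        _ ≤ r l * ((l : ℝ) + 1) ^ (i + 2) := by
            gcongr
            · linarith
            · omega
  have hcdX := contDiff_poleSum hz hsez
  have hcdΦ := contDiff_poleSum hz hse
  -- Dividing the residues by `z l` makes `f = x * q` explicit: `x (e/z) / (x - z) = e / (x - z) + e
  -- / z`. Hence `x * q x` is `x`, plus a constant, plus the real part of the pole sum with residues
  -- `e l`.
  set q : ℝ → ℝ := fun x => 1 + Complex.reCLM (poleSum (fun l => e l / z l) z x) with hq
  set c : ℝ := (∑' l, e l / z l).re with hc
  have hsc : Summable fun l => e l / z l := by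
    have h := summable_poleTerm hz hse 0 0
    refine (h.neg).congr fun l => ?_
    have := hz0 l
    simp only [poleTerm]
    simp
    field_simp
  have hfq : (fun x => x * q x) = fun x => (x + c) + Complex.reCLM (poleSum e z x) := by
    funext x
    have h1 : (x : ℂ) * poleSum (fun l => e l / z l) z x = poleSum e z x + ∑' l, e l / z l := by
      have h2 := summable_poleTerm hz hse 0 x
      have h3 : ∀ l, poleTerm e z 0 l x = e l * ((x : ℂ) - z l)⁻¹ := fun l => by simp [poleTerm]
      simp only [h3] at h2
      rw [poleSum, poleSum, ← h2.tsum_add hsc, ← tsum_mul_left]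
      refine tsum_congr fun l => ?_
      have h4 := hz0 l
      have h5 := sub_ne_zero_of_im_pos (hz l) x
      field_simp
      ring
    have h6 := congrArg Complex.re h1
    rw [Complex.re_ofReal_mul, Complex.add_re] at h6
    simp only [hq, Complex.reCLM_apply]
    rw [mul_add, h6]; ring
  have hDX : DCOn m (Ico 0 1) (poleSum (fun l => e l / z l) z) :=
    DCOn.of_bounds hm (fun x _ => hcdX.contDiffAt) (A := 1 / 2) (B := 1)
      (fun i x hx => (hMez i x hx.1).trans_eq (by rw [one_pow]; ring)) zero_le_one
  have hDΦ : DCOn m (Ico 0 1) (poleSum e z) :=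
    DCOn.of_bounds hm (fun x _ => hcdΦ.contDiffAt) (A := 1 / 2) (B := 1)
      (fun i x hx => (hMe i x hx.1).trans_eq (by rw [one_pow]; ring)) zero_le_one
  have hDK : DCOn k (Ioo (-1) 1) (poleSum e z) := by
    refine DCOn.of_bounds hk (fun x _ => hcdΦ.contDiffAt) (A := 2) (B := 1) (fun i x _ => ?_)
      zero_le_one
    refine (norm_iteratedDeriv_poleSum_le hz hse (C := k i) fun l => ?_).trans_eq
      (by rw [one_pow]; ring)
    refine le_trans ?_ (hKe i l)
    have := hz l
    gcongr
    exact im_le_norm_sub _ _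
  refine ⟨q, contDiff_const.add (Complex.reCLM.contDiff.comp hcdX), fun x hx => ?_,
    (DCOn.const hm 1).add hm (hDX.clm Complex.reCLM hm), ?_, ?_, fun l => ⟨J l, by linarith [hJ l], ?_⟩⟩
  · have h1 := hMez 0 x hx
    rw [iteratedDeriv_zero, hm.zero] at h1
    have h2 := (abs_le.1 ((Complex.abs_re_le_norm _).trans h1)).1
    simp only [Nat.factorial_zero, Nat.cast_one] at h2
    simp only [hq, Complex.reCLM_apply]
    linarith
  · rw [hfq]
    refine ((DCOn.id hm fun x hx => ?_).add hm (DCOn.const hm c)).add hm (hDΦ.clm Complex.reCLM hm)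
    rw [abs_of_nonneg hx.1]; exact hx.2.le
  · rw [hfq]
    exact ((DCOn.id hk fun x hx => (abs_lt.2 hx).le).add hk (DCOn.const hk c)).add hk
      (hDK.clm Complex.reCLM hk)
  · set x : ℝ := -((l : ℝ) + 1)⁻¹ with hx
    set j := J l with hj
    have hle : ((j : ℕ) : WithTop ℕ∞) ≤ ∞ := by exact_mod_cast le_top
    have h1 : iteratedDeriv j (fun x => x * q x) x = (iteratedDeriv j (poleSum e z) x).re := by
      rw [hfq, iteratedDeriv_fun_add (f := fun x : ℝ => x + c)
        (g := fun x => Complex.reCLM (poleSum e z x)) (contDiffAt_id.add contDiffAt_const)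
        ((Complex.reCLM.contDiff.comp hcdΦ).contDiffAt.of_le hle),
        iteratedDeriv_add_const_of_two_le (hJ l), zero_add, iteratedDeriv_eq_iteratedFDeriv]
      have := Complex.reCLM.iteratedFDeriv_comp_left (hcdΦ.contDiffAt (x := x)) hle
      rw [iteratedDeriv_eq_iteratedFDeriv]
      exact congrArg (fun M => M fun _ => 1) this
    set D : ℝ := ((l : ℝ) + 1) * (l + 2) with hD
    have hlz : (0 : ℝ) ≤ l := hl0 l
    have hD0 : 0 < D := by positivity
    have hmain : poleTerm e z j l x = (((j ! : ℝ) * (r l * (b l)⁻¹ ^ (j + 1)) : ℝ) : ℂ) := by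
      have h2 : (x : ℂ) - z l = -Complex.I * (b l : ℂ) := by
        have hzl : z l = (x : ℂ) + b l * Complex.I := by
          apply Complex.ext <;> simp only [hzdef, ← hx] <;> simp
        rw [hzl]; ring
      have h3 : (-Complex.I) ^ (j + 1) * ((-Complex.I)⁻¹) ^ (j + 1) = 1 := by
        rw [← mul_pow, mul_inv_cancel₀ (by simp), one_pow]
      have h4 : ((-1 : ℂ)) ^ j * (-1) ^ j = 1 := by rw [← mul_pow]; simp
      rw [poleTerm, h2, mul_inv, mul_pow]
      simp only [hedef, ← hj]
      push_cast
      calc _ = ((-Complex.I) ^ (j + 1) * ((-Complex.I)⁻¹) ^ (j + 1)) * ((-1 : ℂ) ^ j * (-1) ^ j) *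
            ((j ! : ℂ) * ((r l : ℂ) * ((b l : ℂ)⁻¹) ^ (j + 1))) := by ring
        _ = _ := by rw [h3, h4]; ring
    -- The other poles are at distance at least `D⁻¹`, and their residues sum to at most 1; the
    -- extra power of `D` in `hbig` was reserved for them.
    have hrest : ‖∑' l', (if l' = l then 0 else poleTerm e z j l' x)‖ ≤ (j ! : ℝ) * D ^ (j + 1) := by
      have hg : HasSum (fun l' : ℕ => (j ! : ℝ) * D ^ (j + 1) * (1 / 2) * (1 / 2 : ℝ) ^ l')
          ((j ! : ℝ) * D ^ (j + 1) * (1 / 2) * 2) := hasSum_geometric_two.mul_left _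
      refine (tsum_of_norm_bounded hg fun l' => ?_).trans_eq (by ring)
      split_ifs with hll
      · rw [norm_zero]; positivity
      · rw [norm_poleTerm, hen]
        have h5 : ‖(x : ℂ) - z l'‖⁻¹ ≤ D := by
          refine inv_le_of_inv_le₀ hD0 ((le_abs_inv_sub_inv hll).trans ?_)
          exact sub_re_le_norm_sub (z l') x
        have h6 : r l' ≤ 1 / 2 * (1 / 2 : ℝ) ^ l' := by
          have h7 := hMq 0 l'
          rw [hm.zero] at h7
          have h8 : r l' ≤ r l' * ((l' : ℝ) + 1) ^ (0 + 2) :=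
            le_mul_of_one_le_right (hr l').le (one_le_pow₀ (by linarith [hl0 l']))
          refine h8.trans (h7.trans ?_)
          gcongr
          norm_num
        calc _ ≤ (j ! : ℝ) * ((1 / 2 * (1 / 2 : ℝ) ^ l') * D ^ (j + 1)) := by gcongr
          _ = _ := by ring
    have hsplit : iteratedDeriv j (poleSum e z) x = poleTerm e z j l x +
        ∑' l', (if l' = l then 0 else poleTerm e z j l' x) := by
      rw [iteratedDeriv_poleSum hz hse]
      exact (summable_poleTerm hz hse j x).tsum_eq_add_tsum_ite l
    rw [h1, hsplit, Complex.add_re, hmain, Complex.ofReal_re]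
    have h10 := (abs_le.1 ((Complex.abs_re_le_norm _).trans hrest)).1
    have h11 := mul_le_mul_of_nonneg_left (hbig l) (by positivity : (0 : ℝ) ≤ (j ! : ℝ))
    refine le_trans ?_ (le_abs_self _)
    rw [mul_add] at h11
    linarith

/-! ### From a preparation to an extension -/

lemma InRing.mono {m m' : ℕ → ℝ} (h : ∀ j, m j ≤ m' j) {n : ℕ} {f : (Fin n → ℝ) → ℂ}
    (hf : InRing m f) : InRing m' f := by
  obtain ⟨U, hU, h0, hfc, A, B, hA, hB, H⟩ := hf
  exact ⟨U, hU, h0, hfc, A, B, hA, hB, fun x hx α => (H x hx α).trans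
    (mul_le_mul_of_nonneg_left (h _) (by positivity))⟩

/-- Otherwise dividing by `t ^ e` and letting `t → 0` forces `U 0 = 0`. Applied in both directions
it identifies the degree of the polynomial. -/
lemma not_lt_of_pow_mul_eventuallyEq {U Q : ℝ → ℂ} (hU : ContinuousAt U 0) (hQ : ContinuousAt Q 0)
    (hU0 : U 0 ≠ 0) {e e' : ℕ} (h : ∀ᶠ t : ℝ in 𝓝 0, (t : ℂ) ^ e' * Q t = U t * (t : ℂ) ^ e) :
    ¬ e < e' := by
  intro hlt
  have h1 : ∀ᶠ t : ℝ in 𝓝[≠] 0, (t : ℂ) ^ (e' - e) * Q t = U t := by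
    filter_upwards [h.filter_mono nhdsWithin_le_nhds, self_mem_nhdsWithin] with t ht ht0
    have htc : (t : ℂ) ^ e ≠ 0 := pow_ne_zero _ (by exact_mod_cast ht0)
    apply mul_right_cancel₀ htc
    rw [← ht, ← Nat.sub_add_cancel hlt.le, pow_add]
    simp only [Nat.add_sub_cancel]
    ring
  have h2 : Tendsto U (𝓝[≠] 0) (𝓝 (U 0)) := hU.tendsto.mono_left nhdsWithin_le_nhds
  have hc : ContinuousAt (fun t : ℝ => (t : ℂ) ^ (e' - e) * Q t) 0 :=
    (Complex.continuous_ofReal.continuousAt.pow _).mul hQ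
  have h3 := (hc.tendsto.mono_left (nhdsWithin_le_nhds (s := {0}ᶜ))).congr' h1
  have h4 := tendsto_nhds_unique h2 h3
  rw [Complex.ofReal_zero, zero_pow (by omega), zero_mul] at h4
  exact hU0 h4

lemma tendsto_snoc {d : ℕ} {X : Type*} {F : Filter X} {y : X → Fin d → ℝ} {t : X → ℝ}
    (hy : Tendsto y F (𝓝 0)) (ht : Tendsto t F (𝓝 0)) :
    Tendsto (fun x => (Fin.snoc (α := fun _ => ℝ) (y x) (t x) : Fin (d + 1) → ℝ)) F (𝓝 0) := by
  rw [tendsto_pi_nhds] at hy ⊢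
  intro i
  refine Fin.lastCases ?_ (fun j => ?_) i
  · simpa using ht
  · simpa using hy j

/-- The inverse function theorem in Denjoy–Carleman classes: a right germ with a left inverse in the
class extends to the class. -/
lemma extendsTo_of_left_inverse {m : ℕ → ℝ} (hm : IsWeight m) {δ : ℝ} (hδ : 0 < δ) {b f : ℝ → ℝ}
    (hb : DCOn m (Ioo (-δ) δ) b) {f' : ℝ} (hf : HasDerivAt f f' 0) (hf0 : f 0 = 0)
    (hf' : 0 < f') (hbf : ∀ᶠ σ in 𝓝[≥] 0, b (f σ) = σ) : ExtendsTo m (fun x => (f x : ℂ)) := by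
  have h0 : (0 : ℝ) ∈ Ioo (-δ) δ := ⟨by linarith, hδ⟩
  have hbs := (hb.contDiffAt 0 h0).hasStrictDerivAt (by simp)
  have hb0 : b 0 = 0 := by
    have := hbf.self_of_nhdsWithin self_mem_Ici
    rwa [hf0] at this
  have hcomp : HasDerivWithinAt (fun σ => b (f σ)) (deriv b 0 * f') (Ici 0) 0 := by
    have h1 : HasDerivAt b (deriv b 0) (f 0) := by rw [hf0]; exact hbs.hasDerivAt
    exact (h1.comp 0 hf).hasDerivWithinAt
  have hid : HasDerivWithinAt (fun σ => b (f σ)) 1 (Ici 0) 0 :=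
    (hasDerivWithinAt_id 0 (Ici 0)).congr_of_eventuallyEq hbf (by rw [hf0, hb0])
  -- A one-sided identity suffices, since derivatives within `[0, ∞)` are unique at 0.
  have hprod : deriv b 0 * f' = 1 := (uniqueDiffWithinAt_Ici 0).eq_deriv _ hcomp hid
  have hbpos : 0 < deriv b 0 := by
    by_contra hneg
    nlinarith [not_lt.1 hneg]
  set c := deriv b 0 / 2 with hc
  have hc0 : 0 < c := by positivity
  have hdc : ContinuousAt (deriv b) 0 := ((hb.deriv hm).contDiffAt 0 h0).continuousAt
  have hev : ∀ᶠ x in 𝓝 (0 : ℝ), c < deriv b x ∧ x ∈ Ioo (-δ) δ :=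
    (hdc.eventually (lt_mem_nhds (by rw [hc]; linarith))).and (isOpen_Ioo.mem_nhds h0)
  obtain ⟨ε, hε, hball⟩ := Metric.eventually_nhds_iff_ball.1 hev
  rw [Real.ball_eq_Ioo, zero_sub, zero_add] at hball
  -- The local inverse `ψ` of `b` satisfies `ψ' = w ∘ ψ`, and `w` is in the class by `DCOn.deriv`
  -- and `DCOn.inv`.
  set w : ℝ → ℝ := fun x => (deriv b x)⁻¹ with hw
  have hwD : DCOn m (Ioo (-ε) ε) w :=
    ((hb.deriv hm).mono fun x hx => (hball x hx).2).inv hm hc0 fun x hx =>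
      (hball x hx).1.le.trans (le_abs_self _)
  set e := (hbs.hasStrictFDerivAt_equiv hbpos.ne').toOpenPartialHomeomorph b with he
  have hecoe : ∀ x, e x = b x := fun x => rfl
  have h0s : (0 : ℝ) ∈ e.source :=
    (hbs.hasStrictFDerivAt_equiv hbpos.ne').mem_toOpenPartialHomeomorph_source
  have h0t : (0 : ℝ) ∈ e.target := by
    have := e.map_source h0s
    rwa [hecoe, hb0] at this
  have hsymm0 : e.symm 0 = 0 := by
    have := e.left_inv h0s
    rwa [hecoe, hb0] at this
  have hopen : IsOpen (e.target ∩ e.symm ⁻¹' Ioo (-ε) ε) :=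
    e.isOpen_inter_preimage_symm isOpen_Ioo
  have hode : DCOn m (e.target ∩ e.symm ⁻¹' Ioo (-ε) ε) e.symm := by
    refine hwD.of_ode hm hopen (fun y hy => hy.2) (fun y hy => ?_) (D := ε)
      (fun y hy => (abs_lt.2 hy.2).le)
    have h1 := hball _ hy.2
    have h2 : HasDerivAt e (deriv b (e.symm y)) (e.symm y) :=
      ((hb.contDiffAt _ h1.2).differentiableAt (by simp)).hasDerivAt
    exact e.hasDerivAt_symm hy.1 (hc0.trans h1.1).ne' h2
  refine ⟨fun y => Complex.ofRealCLM (e.symm (y 0)),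
    inRing_comp_proj (p := fun t => Complex.ofRealCLM (e.symm t)) hopen
      ⟨h0t, by rw [mem_preimage, hsymm0]; exact ⟨by linarith, hε⟩⟩ (hode.clm Complex.ofRealCLM hm) 0,
    ?_⟩
  have hsrc : ∀ᶠ σ in 𝓝[≥] (0 : ℝ), f σ ∈ e.source := by
    have : Tendsto f (𝓝[≥] 0) (𝓝 0) := by
      have := hf.continuousAt.tendsto
      rw [hf0] at this
      exact this.mono_left nhdsWithin_le_nhds
    exact this.eventually (e.open_source.mem_nhds h0s)
  filter_upwards [hsrc, hbf] with σ hs hσ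
  have := e.left_inv hs
  rw [hecoe, hσ] at this
  simp [this]

/-- The substitution `t ↦ t²` pairs the roots: a degree-2 polynomial vanishing at `±τ` has constant
term `-τ²`. Thus `a 0` inverts `f` up to sign, on the right of 0, within the class. -/
lemma extendsTo_of_canBePrepared {m : ℕ → ℝ} (hm : IsWeight m) {d : ℕ} (hd : 1 ≤ d) {q : ℝ → ℝ}
    (hq : ContDiff ℝ ∞ q) (hq0 : 0 < q 0)
    (h : CanBePrepared m fun x : Fin (d + 1) → ℝ =>
      ((x (Fin.last d) ^ 2 * q (x (Fin.last d) ^ 2) : ℝ) : ℂ) - (x 0 : ℂ)) :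
    ExtendsTo m (fun x => ((x * q x : ℝ) : ℂ)) := by
  obtain ⟨e, u, P, ⟨hu, v, -, huv⟩, ⟨a, ha, hP⟩, hg⟩ := h
  have hev : ∀ᶠ x : Fin (d + 1) → ℝ in 𝓝 0,
      ((x (Fin.last d) ^ 2 * q (x (Fin.last d) ^ 2) : ℝ) : ℂ) - (x 0 : ℂ) =
        u x * ((x (Fin.last d) : ℂ) ^ e
          + ∑ j : Fin e, a j (Fin.init x) * (x (Fin.last d) : ℂ) ^ (j : ℕ)) ∧ u x ≠ 0 := by
    filter_upwards [huv, hP, hg] with x h1 h2 h3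
    exact ⟨by rw [h3, h2], left_ne_zero_of_mul_eq_one h1⟩
  have hu0 : u 0 ≠ 0 := hev.self_of_nhds.2
  set i₀ : Fin d := ⟨0, hd⟩
  have hcast : (0 : Fin (d + 1)) = Fin.castSucc i₀ := rfl
  have he : e = 2 := by
    have hpath := (tendsto_snoc (d := d) (y := fun _ : ℝ => 0) tendsto_const_nhds
      (tendsto_id (x := 𝓝 (0 : ℝ)))).eventually hev
    have hsn0 : (Fin.snoc (α := fun _ => ℝ) (0 : Fin d → ℝ) (0 : ℝ) : Fin (d + 1) → ℝ) = 0 := by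
      funext i
      refine Fin.lastCases ?_ (fun j => ?_) i <;> simp
    have hU : ContinuousAt (fun t : ℝ => u (Fin.snoc (α := fun _ => ℝ) (0 : Fin d → ℝ) t)) 0 := by
      have h1 := tendsto_snoc (d := d) (y := fun _ : ℝ => 0) tendsto_const_nhds
        (tendsto_id (x := 𝓝 (0 : ℝ)))
      have h2 := (hu.contDiffAt.continuousAt.tendsto).comp h1
      unfold ContinuousAt
      beta_reduce
      rw [hsn0]
      exact h2
    have hQ : ContinuousAt (fun t : ℝ => (q (t ^ 2) : ℂ)) 0 :=
      (Complex.continuous_ofReal.comp (hq.continuous.comp (continuous_pow 2))).continuousAt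
    have hmain : ∀ᶠ t : ℝ in 𝓝 0, (t : ℂ) ^ 2 * (q (t ^ 2) : ℂ) =
        u (Fin.snoc (α := fun _ => ℝ) (0 : Fin d → ℝ) t) * (t : ℂ) ^ e := by
      filter_upwards [hpath] with t ht
      have h1 := ht.1
      rw [hcast] at h1
      simp only [Fin.snoc_last, Fin.snoc_castSucc, Fin.init_snoc, (ha _).2, id] at h1
      simpa using h1
    have h1 := not_lt_of_pow_mul_eventuallyEq hU hQ (by rw [hsn0]; exact hu0) hmain
    have h2 := not_lt_of_pow_mul_eventuallyEq hQ hU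
      (by simpa using hq0.ne') (e := 2) (e' := e)
      (by filter_upwards [hmain] with t ht; rw [mul_comm, ← ht, mul_comm])
    omega
  subst he
  set f : ℝ → ℝ := fun x => x * q x with hf
  have hfc : Continuous f := continuous_id.mul hq.continuous
  have hf0 : f 0 = 0 := by simp [hf]
  have hsingle : Tendsto (fun τ : ℝ => (Pi.single i₀ (f (τ ^ 2)) : Fin d → ℝ)) (𝓝 0) (𝓝 0) := by
    have hc : Continuous fun τ : ℝ => (Pi.single i₀ (f (τ ^ 2)) : Fin d → ℝ) :=
      (ContinuousLinearMap.single ℝ (fun _ : Fin d => ℝ) i₀).continuous.comp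
        (hfc.comp (continuous_pow 2))
    have := hc.tendsto 0
    simpa [hf0] using this
  -- Adding the equations at `τ` and `-τ` cancels the linear coefficient; the unit does not vanish
  -- near 0, so it is the polynomial that vanishes.
  have hroot : ∀ᶠ τ : ℝ in 𝓝 0, a 0 (Pi.single i₀ (f (τ ^ 2))) = -(τ : ℂ) ^ 2 := by
    have hneg : Tendsto (fun τ : ℝ => -τ) (𝓝 0) (𝓝 0) := by
      have := (continuous_neg (G := ℝ)).tendsto 0
      simpa using this
    filter_upwards [(tendsto_snoc hsingle tendsto_id).eventually hev,
      (tendsto_snoc hsingle hneg).eventually hev] with τ h1 h2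
    obtain ⟨h1, h1'⟩ := h1
    obtain ⟨h2, h2'⟩ := h2
    rw [hcast] at h1 h2
    simp only [Fin.snoc_last, Fin.snoc_castSucc, Fin.init_snoc, Pi.single_eq_same, id, neg_sq,
      Fin.sum_univ_two, hf, sub_self] at h1 h2 h1' h2'
    have h3 := (mul_eq_zero.1 h1.symm).resolve_left h1'
    have h4 := (mul_eq_zero.1 h2.symm).resolve_left h2'
    simp only [Fin.val_zero, pow_zero, mul_one, Fin.val_one, pow_one, Complex.ofReal_neg,
      neg_sq] at h3 h4
    have h5 : 2 * (a 0 (Pi.single i₀ (f (τ ^ 2))) + (τ : ℂ) ^ 2) = 0 := by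
      simp only [hf]
      linear_combination h3 + h4
    have h6 := (mul_eq_zero.1 h5).resolve_left two_ne_zero
    exact eq_neg_of_add_eq_zero_left h6
  obtain ⟨δ, hδ, hD⟩ := (ha 0).1.exists_dcOn i₀
  -- The coefficient is complex-valued, but its values on the image of `f` are real, so the negative
  -- real part is a real left inverse; below it is evaluated with `τ = √σ`.
  have hbD := hD.clm (-Complex.reCLM) hm
  refine extendsTo_of_left_inverse hm hδ hbD (f := f) (f' := q 0) ?_ hf0 hq0 ?_
  · have := (hasDerivAt_id (0 : ℝ)).mul ((hq.differentiable (by simp)) 0).hasDerivAt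
    exact this.congr_deriv (by simp)
  · have hsqrt : Tendsto Real.sqrt (𝓝[≥] 0) (𝓝 0) := by
      have := Real.continuous_sqrt.tendsto 0
      rw [Real.sqrt_zero] at this
      exact this.mono_left nhdsWithin_le_nhds
    filter_upwards [hsqrt.eventually hroot, self_mem_nhdsWithin] with σ h1 h2
    rw [Real.sq_sqrt h2, ← Complex.ofReal_pow, Real.sq_sqrt h2] at h1
    simp [h1]

lemma norm_iteratedDeriv_ofReal_comp {f : ℝ → ℝ} {x : ℝ} (hf : ContDiffAt ℝ ∞ f x) (j : ℕ) :
    ‖iteratedDeriv j (fun x => (f x : ℂ)) x‖ = ‖iteratedDeriv j f x‖ := by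
  rw [← norm_iteratedFDeriv_eq_norm_iteratedDeriv, ← norm_iteratedFDeriv_eq_norm_iteratedDeriv]
  exact Complex.ofRealLI.norm_iteratedFDeriv_comp_left hf (by exact_mod_cast le_top)

/-! ### Non-extension and the main theorem -/

/-- A germ of the quasi-analytic class of `k` whose derivatives at `-1 / (l + 1)` exceed all bounds
of the smaller class of `m` does not extend to that class from the right. -/
lemma not_extendsTo {m k : ℕ → ℝ} (hm : IsWeight m) (hk : IsWeight k) (hmk : ∀ j, m j ≤ k j)
    (hdiv : ¬ Summable fun j : ℕ => k j / ((j + 1) * k (j + 1))) {f : ℝ → ℂ}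
    (hfk : InRing k fun y : Fin 1 → ℝ => f (y 0)) (hfc : ContDiffAt ℝ ∞ f 0)
    (hbig : ∀ l : ℕ, ∃ j : ℕ, 1 ≤ j ∧ (j ! : ℝ) * (((l : ℝ) + 1) ^ j * m j) ≤
      ‖iteratedDeriv j f (-((l : ℝ) + 1)⁻¹)‖) : ¬ ExtendsTo m f := by
  rintro ⟨h, hh, heq⟩
  have h3 : ∀ t : ℝ, (Pi.single 0 t : Fin 1 → ℝ) = fun _ => t := fun t => by
    funext i; rw [Subsingleton.elim i 0]; simp
  obtain ⟨δ, hδ, hD⟩ := hh.exists_dcOn 0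
  simp only [h3] at hD
  have hhc := hD.contDiffAt 0 ⟨by linarith, hδ⟩
  have hle : ∀ n : ℕ, (n : WithTop ℕ∞) ≤ ∞ := fun n => by exact_mod_cast le_top
  -- Derivatives at 0 are limits from the right, where the two functions agree.
  have hT : taylor h = taylor fun y : Fin 1 → ℝ => f (y 0) := by
    rw [taylor_fin_one_eq_iff hh hfk]
    intro n
    have := iteratedDeriv_eq_zero_of_right (hhc.sub hfc) (by
      filter_upwards [heq.filter_mono (nhdsWithin_mono 0 Ioi_subset_Ici_self)] with t ht
      rw [ht, sub_self]) n
    rw [iteratedDeriv_fun_sub (hhc.of_le (hle n)) (hfc.of_le (hle n))] at this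
    exact sub_eq_zero.1 this
  have hgerm := taylor_injective_fin_one hk hdiv (hh.mono hmk) hfk hT
  have hc : Tendsto (fun t : ℝ => (fun _ => t : Fin 1 → ℝ)) (𝓝 0) (𝓝 0) :=
    tendsto_pi_nhds.2 fun _ => tendsto_id
  have hline : ∀ᶠ t in 𝓝 (0 : ℝ), h (fun _ => t) = f t := hc.eventually hgerm
  obtain ⟨A, B, hA, hB, H⟩ := hD.exists_bound_one_le hm
  have hlim : Tendsto (fun l : ℕ => -((l : ℝ) + 1)⁻¹) atTop (𝓝 0) := by
    have := (tendsto_one_div_add_atTop_nhds_zero_nat (𝕜 := ℝ)).neg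
    simpa using this
  -- Taking `l ≥ A * B` contradicts `(l + 1) ^ j ≤ A * B ^ j ≤ (A * B) ^ j`; this uses `j ≥ 1`.
  obtain ⟨l, hl1, hl2, hl3⟩ := ((hlim.eventually hline.eventually_nhds).and
    ((hlim.eventually (isOpen_Ioo.mem_nhds (show (0 : ℝ) ∈ Ioo (-δ) δ from ⟨by linarith, hδ⟩))).and
      (tendsto_natCast_atTop_atTop.eventually_ge_atTop (A * B)))).exists
  obtain ⟨j, hj, hbig⟩ := hbig l
  have h4 := H j _ hl2
  rw [Filter.EventuallyEq.iteratedDeriv_eq j hl1] at h4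
  have h5 := hbig.trans h4
  have hmj := hm.pos j
  have hjf : (0 : ℝ) < (j ! : ℝ) := by positivity
  have h6 : ((l : ℝ) + 1) ^ j ≤ A * B ^ j := by
    refine le_of_mul_le_mul_left ?_ (mul_pos hjf hmj)
    linarith
  have h7 : A * B ^ j ≤ (A * B) ^ j := by
    rw [mul_pow]
    gcongr
    exact le_self_pow₀ hA (by omega)
  have h8 : (l : ℝ) + 1 ≤ A * B :=
    le_of_pow_le_pow_left₀ (by omega) (by positivity) (h6.trans h7)
  linarith

end DenjoyCarleman

/-- Here `n = d + 1 ≥ 2`, the variables are `x = (x', t)` with `t = x (Fin.last d)`; the sequences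
`m`, `m'` and `k` are the weights `M`, `M̃` and `K`. -/
theorem mainTheorem1 (d : ℕ) (hd : 1 ≤ d) (m m' : ℕ → ℝ)
    (hm : DenjoyCarleman.IsWeight m) (hm' : DenjoyCarleman.IsWeight m')
    (hqa : DenjoyCarleman.IsQuasiAnalytic m (d + 1))
    (hqa' : DenjoyCarleman.IsQuasiAnalytic m' (d + 1))
    (hle : DenjoyCarleman.RingLE m m' (d + 1)) :
    ∃ g : (Fin (d + 1) → ℝ) → ℂ,
      DenjoyCarleman.InRing m g ∧
      DenjoyCarleman.IsRegular m 2 g ∧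
      ¬ DenjoyCarleman.CanBePrepared m' g ∧
      ∃ (f : ℝ → ℂ) (k : ℕ → ℝ),
        DenjoyCarleman.IsWeight k ∧
        DenjoyCarleman.IsQuasiAnalytic k 1 ∧
        DenjoyCarleman.RingLE m' k 1 ∧
        DenjoyCarleman.InHalfRing m f ∧
        DenjoyCarleman.InRing k (fun y : Fin 1 → ℝ => f (y 0)) ∧
        ¬ DenjoyCarleman.ExtendsTo m' f ∧
        ∀ x : Fin (d + 1) → ℝ, g x = f (x (Fin.last d) ^ 2) - (x 0 : ℂ) := by
  open DenjoyCarleman Set Filter Topology ContDiff Nat in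
  have hunb : ¬ ∃ C : ℝ, ∀ j, m j ≤ C ^ j := by
    rintro ⟨C, hC⟩
    exact hqa.analytic_ssubset.2 fun f hf => InRing.analyticAt hf (fun j => (hm.pos j).le) hC
  obtain ⟨k, hk, hmk, hdiv, hgrow⟩ :=
    exists_larger_weight hm' (not_summable_of_taylor_injective hm' hqa'.taylor_injective)
  obtain ⟨q, hqc, hqpos, hqD, hfD, hfK, hbig⟩ :=
    exists_half_regular_function hm hm' hk hgrow (hm.exists_pow_le hunb)
  have hfc : ContDiff ℝ ∞ fun x => x * q x := contDiff_id.mul hqc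
  have hfcc : ContDiff ℝ ∞ fun x => ((x * q x : ℝ) : ℂ) := Complex.ofRealCLM.contDiff.comp hfc
  have h01 : (0 : ℝ) ∈ Ioo (-1 : ℝ) 1 := by norm_num
  have hfInK : InRing k fun y : Fin 1 → ℝ => ((y 0 * q (y 0) : ℝ) : ℂ) :=
    inRing_comp_proj isOpen_Ioo h01 (hfK.clm Complex.ofRealCLM hk) 0
  have hnot : ¬ ExtendsTo m' fun x => ((x * q x : ℝ) : ℂ) := by
    refine not_extendsTo hm' hk hmk hdiv hfInK hfcc.contDiffAt fun l => ?_
    obtain ⟨j, hj, h⟩ := hbig l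
    exact ⟨j, hj, by rwa [norm_iteratedDeriv_ofReal_comp hfc.contDiffAt]⟩
  -- On the `t`-axis the germ is `t² q(t²)`, so `q(t²)`, bounded below by `1/2`, is the unit
  -- witnessing regularity.
  have hsq : DCOn m (Ioo (-1) 1) fun t => q (t ^ 2) := hqD.comp_sq hm hqc
  refine ⟨fun x => ((x (Fin.last d) ^ 2 * q (x (Fin.last d) ^ 2) : ℝ) : ℂ) - (x 0 : ℂ), ?_, ?_,
    fun h => hnot (extendsTo_of_canBePrepared hm' hd hqc
      (lt_of_lt_of_le (by norm_num) (hqpos 0 le_rfl)) h),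
    fun x => ((x * q x : ℝ) : ℂ), k, hk, ⟨⟨?_, fun hsub => ?_⟩, ?_⟩,
    fun f hf => hf.mono hmk, ?_, hfInK, hnot, fun x => rfl⟩
  · exact InRing.sub hm
      (inRing_comp_proj isOpen_Ioo h01 ((hfD.comp_sq hm hfc).clm Complex.ofRealCLM hm) (Fin.last d))
      (inRing_comp_proj isOpen_Ioo h01
        ((DCOn.id hm fun x hx => (abs_lt.2 hx).le).clm Complex.ofRealCLM hm) 0)
  · refine ⟨fun x => (q (x (Fin.last d) ^ 2) : ℂ),
      ⟨inRing_comp_proj isOpen_Ioo h01 (hsq.clm Complex.ofRealCLM hm) (Fin.last d),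
        fun x => (((q (x (Fin.last d) ^ 2))⁻¹ : ℝ) : ℂ), ?_, ?_⟩, ?_⟩
    · exact inRing_comp_proj isOpen_Ioo h01 ((hsq.inv hm (show (0 : ℝ) < 1 / 2 by norm_num)
        fun x _ => (hqpos _ (sq_nonneg x)).trans (le_abs_self _)).clm Complex.ofRealCLM hm)
        (Fin.last d)
    · refine Eventually.of_forall fun x => ?_
      have := hqpos _ (sq_nonneg (x (Fin.last d)))
      rw [← Complex.ofReal_mul, mul_inv_cancel₀ (by linarith), Complex.ofReal_one]
    · refine Eventually.of_forall fun t => ?_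
      rw [show (0 : Fin (d + 1)) = Fin.castSucc ⟨0, hd⟩ from rfl]
      simp only [Fin.snoc_last, Fin.snoc_castSucc]
      push_cast
      simp [mul_comm]
  · exact fun f hf => inRing_of_analyticAt_fin_one hk hf
  -- `f` itself shows that the class of `k` is not just the analytic germs: if it were analytic it
  -- would lie in the class of `m'`.
  · exact hnot ⟨_, inRing_of_analyticAt_fin_one hm' (hsub hfInK), Eventually.of_forall fun t => rfl⟩
  · exact fun f g hf hg h => taylor_injective_fin_one hk hdiv hf hg h
  · obtain ⟨A, B, hA, hB, H⟩ := (hfD.clm Complex.ofRealCLM hm).bound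
    refine ⟨1, one_pos, hfcc.contDiffOn, A, B, hA, hB, fun j x hx => ?_⟩
    rw [iteratedDerivWithin_eq_iteratedDeriv (uniqueDiffOn_Ico 0 1)
      (hfcc.contDiffAt.of_le (by exact_mod_cast le_top)) hx]
    exact H j x hx
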